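/- Let $m\ge 1$, $n=2m$, $q=2^n$, let $k$ be an integer with $1\le k\le n-1$ and $k\ne m$, and put $d=\gcd(m,k)$, $d'=\gcd(m+k,2k)$. Let $\mathbb F_{2^m}\subset\mathbb F_q$ be the finite fields with $2^m$ and $q$ elements, with absolute traces $\mathrm{Tr}_1^m:\mathbb F_{2^m}\to\mathbb F_2$ and $\mathrm{Tr}_1^n:\mathbb F_q\to\mathbb F_2$, and let $\pi$ be a primitive element of $\mathbb F_q$. For $\alpha\in\mathbb F_{2^m}$ and $\beta\in\mathbb F_q$ put \[T(\alpha,\beta)=\sum_{x\in\mathbb F_q}(-1)^{\mathrm{Tr}_1^m(\alpha x^{2^m+1})+\mathrm{Tr}_1^n(\beta x^{2^k+1})},\qquad c(\alpha,\beta)=\bigl(\mathrm{Tr}_1^m(\alpha\pi^{i(2^m+1)})+\mathrm{Tr}_1^n(\beta\pi^{i(2^k+1)})\bigr)_{i=0}^{q-2}.\] Let $\mathcal C_1$ be the binary cyclic code of length $q-1$ with parity-check polynomial $h_2h_3$, where $h_2,h_3$ are the minimal polynomials over $\mathbb F_2$ of $\pi^{-(2^k+1)}$ and $\pi^{-(2^m+1)}$;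 that is, the set of words $(c_0,\dots,c_{q-2})\in\mathbb F_2^{q-1}$ such that $x^{q-1}-1$ divides $h_2(x)h_3(x)\sum_i c_ix^i$. Then $(\alpha,\beta)\mapsto c(\alpha,\beta)$ is a bijection from $\mathbb F_{2^m}\times\mathbb F_q$ onto $\mathcal C_1$, and the value distribution of the multiset $\{T(\alpha,\beta):\alpha\in\mathbb F_{2^m},\beta\in\mathbb F_q\}$ and the weight distribution of $\mathcal C_1$ are as follows. In each row, the first entry is the value of $T(\alpha,\beta)$, the second is the Hamming weight of $c(\alpha,\beta)$ for the pairs $(\alpha,\beta)$ with this value, and the third is both the number of pairs $(\alpha,\beta)$ with this value and the number of codewords of $\mathcal C_1$ with this weight. No other values and no other weights occur. (i) If $d'=d$: \[\begin{array}{c|c|c} \text{value}&\text{weight}&\text{multiplicity}\\ \hline 2^m & 2^{n-1}-2^{m-1} & \dfrac{2^{d-1}(2^m-1)(2^n+2^{m+1}+1)}{2^d+1}\\ -2^m & 2^{n-1}+2^{m-1} & \dfrac{2^{d-1}(2^m-1)(2^n-2^{n-d+1}+1)}{2^d-1}\\ -2^{m+d} & 2^{n-1}+2^{m+d-1} & \dfrac{(2^{m-d}-1)(2^n-1)}{2^{2d}-1}\\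 0 & 2^{n-1} & 2^{m-d}(2^n-1)\\ 2^n & 0 & 1 \end{array}\] (ii) If $d'=2d$: \[\begin{array}{c|c|c} \text{value}&\text{weight}&\text{multiplicity}\\ \hline -2^m & 2^{n-1}+2^{m-1} & \dfrac{2^{3d}(2^m-1)(2^n-2^{n-2d}-2^{n-3d}+2^m-2^{m-d}+1)}{(2^d+1)(2^{2d}-1)}\\ 2^{m+d} & 2^{n-1}-2^{m+d-1} & \dfrac{2^d(2^n-1)(2^m+2^{m-d}+2^{m-2d}+1)}{(2^d+1)^2}\\ -2^{m+2d} & 2^{n-1}+2^{m+2d-1} & \dfrac{(2^{m-d}-1)(2^n-1)}{(2^d+1)(2^{2d}-1)}\\ 2^n & 0 & 1 \end{array}\] -/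

import Mathlib

open Polynomial

namespace GenKasami

section ExponentialSum

variable {F : Type*} [Field F] [Fintype F] [Algebra (ZMod 2) F]
variable {K : IntermediateField (ZMod 2) F} {n m : ℕ}

/-- If `F` has `2 ^ n` elements with `n = 2 * m` and `K` is its subfield with `2 ^ m` elements,
then `x ^ (2 ^ m + 1)` lies in `K` for every `x` in `F`. -/
theorem pow_mem_subfield (hn : n = 2 * m) (hF : Fintype.card F = 2 ^ n)
    (hK : Nat.card K = 2 ^ m) (x : F) : x ^ (2 ^ m + 1) ∈ K := by
  classical
  have h := FiniteField.algebraMap_norm_eq_pow (K := K) (K' := F) (x := x)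
  have hm : m ≠ 0 := by
    rintro rfl
    have h1 := Finite.one_lt_card (α := K)
    rw [hK] at h1
    simp at h1
  have h2 : 1 < 2 ^ m := Nat.one_lt_two_pow hm
  have e : (2 ^ n - 1) / (2 ^ m - 1) = 2 ^ m + 1 := by
    apply Nat.div_eq_of_eq_mul_left (by omega)
    rw [hn, two_mul, pow_add]
    have := Nat.sq_sub_sq (2 ^ m) 1
    simpa [sq] using this
  rw [Nat.card_eq_fintype_card, hF, hK, e] at h
  rw [← h]
  exact (Algebra.norm K x).2

/-- The element `x ^ (2 ^ m + 1)`, regarded as an element of the subfield `K`. -/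
def powSub (hn : n = 2 * m) (hF : Fintype.card F = 2 ^ n) (hK : Nat.card K = 2 ^ m) (x : F) : K :=
  ⟨x ^ (2 ^ m + 1), pow_mem_subfield hn hF hK x⟩

/-- `Tr_1^m (α x^(2^m+1)) + Tr_1^n (β x^(2^k+1))`, an element of the prime field. -/
noncomputable def traceForm (hn : n = 2 * m) (hF : Fintype.card F = 2 ^ n)
    (hK : Nat.card K = 2 ^ m) (k : ℕ) (α : K) (β : F) (x : F) : ZMod 2 :=
  Algebra.trace (ZMod 2) K (α * powSub hn hF hK x) +
    Algebra.trace (ZMod 2) F (β * x ^ (2 ^ k + 1))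

/-- The exponential sum `T(α, β)`. -/
noncomputable def T (hn : n = 2 * m) (hF : Fintype.card F = 2 ^ n)
    (hK : Nat.card K = 2 ^ m) (k : ℕ) (α : K) (β : F) : ℤ :=
  ∑ x : F, (-1 : ℤ) ^ (traceForm hn hF hK k α β x).val

/-- The word `c(α, β)` of length `2 ^ n - 1`, with entries
`Tr_1^m (α π^(i(2^m+1))) + Tr_1^n (β π^(i(2^k+1)))`. -/
noncomputable def word (hn : n = 2 * m) (hF : Fintype.card F = 2 ^ n)
    (hK : Nat.card K = 2 ^ m) (k : ℕ) (π : Fˣ) (α : K) (β : F) : Fin (2 ^ n - 1) → ZMod 2 :=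
  fun i => traceForm hn hF hK k α β ((π : F) ^ (i : ℕ))

end ExponentialSum

section CyclicCode

/-- The polynomial `c_0 + c_1 X + ⋯ + c_{l-1} X^(l-1)` of a binary word of length `l`. -/
noncomputable def wordPoly {l : ℕ} (c : Fin l → ZMod 2) : (ZMod 2)[X] :=
  ∑ i, C (c i) * X ^ (i : ℕ)

/-- The binary cyclic code of length `l` with parity-check polynomial `h`
(a divisor of `X ^ l - 1`): the words `c` with `c(X) h(X) ≡ 0` modulo `X ^ l - 1`. -/
noncomputable def cyclicCode (l : ℕ) (h : (ZMod 2)[X]) : Submodule (ZMod 2) (Fin l → ZMod 2) where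
  carrier := {c | (X ^ l - 1 : (ZMod 2)[X]) ∣ wordPoly c * h}
  add_mem' := by
    intro a b ha hb
    have e : wordPoly (a + b) * h = wordPoly a * h + wordPoly b * h := by
      simp [wordPoly, add_mul, Finset.sum_add_distrib]
    simpa only [Set.mem_ofPred_eq, e] using dvd_add ha hb
  zero_mem' := by simp [wordPoly]
  smul_mem' := by
    intro r a ha
    have e : wordPoly (r • a) * h = C r * (wordPoly a * h) := by
      simp [wordPoly, Finset.mul_sum, Finset.sum_mul, mul_assoc]
    simpa only [Set.mem_ofPred_eq, e] using Dvd.dvd.mul_left ha (C r)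

variable {F : Type*} [Field F] [Algebra (ZMod 2) F]

/-- The parity-check polynomial `h₂ h₃`, where `h₂` and `h₃` are the minimal polynomials over
the prime field of `π^(-(2^k+1))` and `π^(-(2^m+1))`. -/
noncomputable def parityPoly (m k : ℕ) (π : Fˣ) : (ZMod 2)[X] :=
  minpoly (ZMod 2) ((π : F)⁻¹ ^ (2 ^ k + 1)) * minpoly (ZMod 2) ((π : F)⁻¹ ^ (2 ^ m + 1))

/-- The binary cyclic code `C₁` of length `2 ^ n - 1` with parity-check polynomial `h₂ h₃`. -/
noncomputable def codeC1 (n m k : ℕ) (π : Fˣ) : Submodule (ZMod 2) (Fin (2 ^ n - 1) → ZMod 2) :=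
  cyclicCode (2 ^ n - 1) (parityPoly m k π)

end CyclicCode

section Distribution

variable {F : Type*} [Field F] [Fintype F] [Algebra (ZMod 2) F]
variable {K : IntermediateField (ZMod 2) F} {n m : ℕ}

/-- `rows` (entries: value, weight, multiplicity) is the table of the value distribution of
`T(α, β)`, together with the weight of `c(α, β)`, and of the weight distribution of `C₁`. -/
def IsDistributionTable (hn : n = 2 * m) (hF : Fintype.card F = 2 ^ n)
    (hK : Nat.card K = 2 ^ m) (k : ℕ) (π : Fˣ) (rows : List (ℤ × ℕ × ℚ)) : Prop :=
  (∀ (α : K) (β : F), ∃ r ∈ rows,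
    T hn hF hK k α β = r.1 ∧ hammingNorm (word hn hF hK k π α β) = r.2.1) ∧
  (∀ r ∈ rows, (({p : K × F | T hn hF hK k p.1 p.2 = r.1}.ncard : ℕ) : ℚ) = r.2.2) ∧
  (∀ c ∈ codeC1 n m k π, ∃ r ∈ rows, hammingNorm c = r.2.1) ∧
  (∀ r ∈ rows, (({c | c ∈ codeC1 n m k π ∧ hammingNorm c = r.2.1}.ncard : ℕ) : ℚ) = r.2.2)

end Distribution

end GenKasami

/-!
Write `s`, `c` for the automorphisms `x ↦ x ^ 2 ^ k`, `x ↦ x ^ 2 ^ m`, so that `c` is an involution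
commuting with `s`. Choosing `θ` with `θ + c θ = 1` turns the trace of the subfield into a trace of
`F`, and `T(α, β)` becomes the exponential sum of the quadratic form
`x ↦ Tr (θ α x c(x) + β x s(x))` on `F`. Its radical is the kernel of the linearized polynomial
`x ↦ α c(x) + β s(x) + s⁻¹(β x)`, and the square of the sum is `0` or `2 ^ n` times the size of the
radical. The radical is a vector space over the field of `2 ^ d` elements fixed by `s` and `c`; its
dimension is even, because an alternating form has even rank, and its size is at most the square of
that of the field fixed by `s ∘ c`, which has `2 ^ d'` elements. So `T(α, β)` is known up to sign.

If `d' = d` and the radical is nonzero, it contains some `x ≠ 0` such that `γ = β x s(x)` is fixed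
by `c`. The form at `x y` is then the Hermitian form `z ↦ Tr (θ γ z c(z))` at `z = y + s(c(y))`, and
these `z` make up the orthogonal complement of a totally isotropic subspace, so
the sum over them is the full Hermitian sum `-2 ^ m` or `0`. If `d' = 2 d`, the form is invariant
under multiplication by `(2 ^ d + 1)`-th roots of unity, so `T(α, β) ≡ 1` modulo `2 ^ d + 1`, which
fixes the sign.

The multiplicities solve the linear system given by the first moment of `T`, the average size of the
radical and, for `d' = d`, the second moment of `T`. The value `2 ^ n` is taken only at `(0, 0)`, so
`c(α, β) = 0` only there, and a count of dimensions makes the linear map `c` a bijection onto the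
code.
-/

namespace GenKasami

open LinearMap (BilinForm ker)

theorem charP_two (R : Type*) [Ring R] [Nontrivial R] [Algebra (ZMod 2) R] : CharP R 2 :=
  charP_of_injective_algebraMap (algebraMap (ZMod 2) R).injective 2

attribute [local instance] charP_two

section Sign

/-- The nontrivial additive character `a ↦ (-1) ^ a` of the prime field. -/
noncomputable def sgn : AddChar (ZMod 2) ℤ := AddChar.zmodChar 2 (ζ := -1) (by norm_num)

theorem sgn_apply (a : ZMod 2) : sgn a = (-1) ^ a.val := AddChar.zmodChar_apply _ a

theorem sgn_eq_one_iff {a : ZMod 2} : sgn a = 1 ↔ a = 0 := by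
  revert a
  simp only [sgn_apply]
  decide

theorem sgn_mul_self (a : ZMod 2) : sgn a * sgn a = 1 := by
  rw [← AddChar.map_add_eq_mul, CharTwo.add_self_eq_zero, AddChar.map_zero_eq_one]

open scoped Classical in
theorem sum_sgn_addMonoidHom {G 𝓕 : Type*} [AddGroup G] [Fintype G] [FunLike 𝓕 G (ZMod 2)]
    [AddMonoidHomClass 𝓕 G (ZMod 2)] (f : 𝓕) :
    ∑ x, sgn (f x) = if ∀ x, f x = 0 then (Fintype.card G : ℤ) else 0 := by
  have h := AddChar.sum_eq_ite (sgn.compAddMonoidHom (f : G →+ ZMod 2))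
  have hf : sgn.compAddMonoidHom (f : G →+ ZMod 2) = 0 ↔ ∀ x, f x = 0 := by
    simp only [DFunLike.ext_iff, AddChar.compAddMonoidHom_apply, AddChar.zero_apply,
      sgn_eq_one_iff, AddMonoidHom.coe_coe]
  simpa only [AddChar.compAddMonoidHom_apply, hf, AddMonoidHom.coe_coe] using h

end Sign

section QuadraticForm

variable {V : Type*} [AddCommGroup V] [Module (ZMod 2) V]

/-- The exponential sum of a quadratic form over the prime field. -/
noncomputable def expSum [Fintype V] (Q : QuadraticForm (ZMod 2) V) : ℤ := ∑ x, sgn (Q x)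

theorem sgn_map_add (Q : QuadraticForm (ZMod 2) V) (x y : V) :
    sgn (Q (x + y)) = sgn (Q x) * sgn (Q y) * sgn (Q.polarBilin x y) := by
  rw [QuadraticMap.map_add Q, AddChar.map_add_eq_mul, AddChar.map_add_eq_mul,
    QuadraticMap.polarBilin_apply_apply]

open scoped Classical in
theorem expSum_sq [Fintype V] (Q : QuadraticForm (ZMod 2) V) :
    expSum Q ^ 2 = Fintype.card V * ∑ y : ker Q.polarBilin, sgn (Q y) := by
  calc expSum Q ^ 2
      = ∑ x, ∑ y, sgn (Q x) * sgn (Q (y + x)) := by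
        rw [sq, expSum, Finset.sum_mul_sum]
        exact Finset.sum_congr rfl fun x _ =>
          (Equiv.sum_comp (Equiv.addRight x) fun y => sgn (Q x) * sgn (Q y)).symm
    _ = ∑ y, sgn (Q y) * ∑ x, sgn (Q.polarBilin y x) := by
        rw [Finset.sum_comm]
        simp only [Finset.mul_sum]
        refine Finset.sum_congr rfl fun y _ => Finset.sum_congr rfl fun x _ => ?_
        rw [sgn_map_add]
        linear_combination sgn (Q y) * sgn (Q.polarBilin y x) * sgn_mul_self (Q x)
    _ = ∑ y, if Q.polarBilin y = 0 then Fintype.card V * sgn (Q y) else 0 := by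
        simp only [sum_sgn_addMonoidHom, LinearMap.ext_iff, LinearMap.zero_apply, ite_mul,
          zero_mul, mul_comm (sgn _)]
    _ = Fintype.card V * ∑ y : ker Q.polarBilin, sgn (Q y) := by
        rw [Finset.mul_sum, ← Finset.sum_filter,
          Finset.sum_subtype (p := (· ∈ ker Q.polarBilin)) _ fun y => by simp]

theorem expSum_eq_zero_or_sq_eq [Fintype V] (Q : QuadraticForm (ZMod 2) V) :
    expSum Q = 0 ∨
      expSum Q ^ 2 = Fintype.card V * Nat.card (ker Q.polarBilin) := by
  classical
  let f : ker Q.polarBilin →+ ZMod 2 :=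
    { toFun := fun y => Q y
      map_zero' := Q.map_zero
      map_add' := fun x y => by
        have hx : QuadraticMap.polar Q x y = 0 := LinearMap.congr_fun x.2 (y : V)
        rw [Submodule.coe_add, QuadraticMap.map_add Q, hx, add_zero] }
  have h : ∑ y : ker Q.polarBilin, sgn (Q y) = _ := sum_sgn_addMonoidHom f
  rw [← sq_eq_zero_iff, expSum_sq, Nat.card_eq_fintype_card, h]
  split_ifs
  · exact Or.inr rfl
  · exact Or.inl (mul_zero _)

theorem expSum_sq_of_ker_polarBilin_eq_bot [Fintype V] {Q : QuadraticForm (ZMod 2) V}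
    (hQ : ker Q.polarBilin = ⊥) : expSum Q ^ 2 = Fintype.card V := by
  classical
  rw [expSum_sq, hQ, Fintype.sum_subsingleton _ 0, Submodule.coe_zero, Q.map_zero,
    AddChar.map_zero_eq_one, mul_one]

theorem sum_orthogonal_eq_zero (Q : QuadraticForm (ZMod 2) V)
    (U : Submodule (ZMod 2) V) [Fintype (BilinForm.orthogonal Q.polarBilin U)]
    (hU : U ≤ BilinForm.orthogonal Q.polarBilin U) {u : V} (hu : u ∈ U) (hQu : Q u ≠ 0) :
    ∑ x : BilinForm.orthogonal Q.polarBilin U, sgn (Q x) = 0 := by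
  have hshift (x : BilinForm.orthogonal Q.polarBilin U) : sgn (Q (u + x)) = - sgn (Q x) := by
    have hx : Q.polarBilin u x = 0 := x.2 u hu
    have hsgn : sgn (Q u) = -1 := by
      rw [sgn_apply, Fin.eq_one_of_ne_zero _ hQu]
      rfl
    rw [sgn_map_add, hx, AddChar.map_zero_eq_one, hsgn]
    ring
  have h := Equiv.sum_comp (Equiv.addLeft (⟨u, hU hu⟩ : BilinForm.orthogonal Q.polarBilin U))
    fun x => sgn (Q x)
  simp only [Equiv.coe_addLeft, Submodule.coe_add, hshift, Finset.sum_neg_distrib] at h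
  linarith

theorem sum_orthogonal_eq_expSum [Fintype V] (Q : QuadraticForm (ZMod 2) V)
    (U : Submodule (ZMod 2) V) [Fintype (BilinForm.orthogonal Q.polarBilin U)]
    (hQU : ∀ u ∈ U, Q u = 0) :
    ∑ x : BilinForm.orthogonal Q.polarBilin U, sgn (Q x) = expSum Q := by
  classical
  have hcard : (Fintype.card U : ℤ) ≠ 0 := Nat.cast_ne_zero.mpr Fintype.card_ne_zero
  have horth (x : V) : (∀ u : U, (Q.polarBilin.flip x).domRestrict U u = 0) ↔
      x ∈ BilinForm.orthogonal Q.polarBilin U :=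
    Subtype.forall
  refine mul_left_cancel₀ hcard (Eq.symm ?_)
  calc (Fintype.card U : ℤ) * expSum Q
      = ∑ u : U, ∑ x, sgn (Q (u + x)) := by
        rw [← nsmul_eq_mul, ← Finset.card_univ, ← Finset.sum_const]
        exact Finset.sum_congr rfl fun u _ =>
          (Equiv.sum_comp (Equiv.addLeft (u : V)) fun x => sgn (Q x)).symm
    _ = ∑ x, sgn (Q x) * ∑ u : U, sgn ((Q.polarBilin.flip x).domRestrict U u) := by
        rw [Finset.sum_comm]
        refine Finset.sum_congr rfl fun x _ => ?_
        rw [Finset.mul_sum]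
        refine Finset.sum_congr rfl fun u _ => ?_
        rw [sgn_map_add, hQU u u.2, AddChar.map_zero_eq_one, one_mul, LinearMap.domRestrict_apply,
          LinearMap.flip_apply]
    _ = ∑ x, if x ∈ BilinForm.orthogonal Q.polarBilin U then Fintype.card U * sgn (Q x) else 0 := by
        simp only [sum_sgn_addMonoidHom, horth, ite_mul, zero_mul,
          mul_comm (sgn _)]
    _ = Fintype.card U * ∑ x : BilinForm.orthogonal Q.polarBilin U, sgn (Q x) := by
        rw [Finset.mul_sum, ← Finset.sum_filter,
          Finset.sum_subtype (p := (· ∈ BilinForm.orthogonal Q.polarBilin U)) _ fun y => by simp]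

theorem sum_orthogonal_eq_zero_or_eq_expSum [Fintype V] (Q : QuadraticForm (ZMod 2) V)
    (U : Submodule (ZMod 2) V) [Fintype (BilinForm.orthogonal Q.polarBilin U)]
    (hU : U ≤ BilinForm.orthogonal Q.polarBilin U) :
    ∑ x : BilinForm.orthogonal Q.polarBilin U, sgn (Q x) = 0 ∨
      ∑ x : BilinForm.orthogonal Q.polarBilin U, sgn (Q x) = expSum Q := by
  by_cases hQU : ∀ u ∈ U, Q u = 0
  · exact Or.inr (sum_orthogonal_eq_expSum Q U hQU)
  · push Not at hQU
    obtain ⟨u, hu, hQu⟩ := hQU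
    exact Or.inl (sum_orthogonal_eq_zero Q U hU hu hQu)

end QuadraticForm

section AlternatingForm

open Module (finrank)

variable {k V : Type*} [Field k] [AddCommGroup V] [Module k V] {B : BilinForm k V}

theorem sup_span_singleton_le_orthogonal (hB : B.IsAlt) {W : Submodule k V}
    (hW : W ≤ B.orthogonal W) {y : V} (hy : y ∈ B.orthogonal W) :
    W ⊔ k ∙ y ≤ B.orthogonal (W ⊔ k ∙ y) := by
  have hyW (w : V) (hw : w ∈ W) : B y w = 0 := hB.isRefl w y (hy w hw)
  intro x hx z hz
  simp only [Submodule.mem_sup, Submodule.mem_span_singleton, exists_exists_eq_and] at hx hz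
  obtain ⟨w, hw, a, rfl⟩ := hx
  obtain ⟨w', hw', b, rfl⟩ := hz
  have hww' : B w' w = 0 := hW hw w' hw'
  have hw'y : B w' y = 0 := hy w' hw'
  simp [hww', hw'y, hyW w hw, hB y]

theorem even_finrank_add_finrank_ker [FiniteDimensional k V] (hB : B.IsAlt) :
    Even (finrank k V + finrank k (ker B)) := by
  obtain ⟨W, hW⟩ := exists_maximal_of_wellFoundedGT (fun W => W ≤ B.orthogonal W)
    ⟨(⊥ : Submodule k V), bot_le⟩
  have hperp : B.orthogonal W = W := by
    refine le_antisymm (fun y hy => ?_) hW.prop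
    exact hW.le_of_ge (sup_span_singleton_le_orthogonal hB hW.prop hy) le_sup_left
      (Submodule.mem_sup_right (Submodule.mem_span_singleton_self y))
  have hker : ker B ≤ W := fun x hx => by
    rw [← hperp]
    intro w _
    exact hB.isRefl x w (LinearMap.congr_fun hx w)
  have h := BilinForm.finrank_add_finrank_orthogonal' (B := B) W
  rw [hperp, inf_of_le_right hker] at h
  exact ⟨_, h.symm⟩

theorem even_finrank_add_finrank_ker_of_trace_self {L F : Type*} [Field L] [Field F] [Finite F]
    [Algebra (ZMod 2) L] [Algebra (ZMod 2) F] [Algebra L F] [IsScalarTower (ZMod 2) L F]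
    {φ : F →ₗ[L] F} (hφ : ∀ x, Algebra.trace (ZMod 2) F (φ x * x) = 0) :
    Even (finrank L F + finrank L (ker φ)) := by
  have : Finite L := Finite.of_injective _ (algebraMap L F).injective
  have hker : ker ((Algebra.traceForm L F).compLeft φ) = ker φ :=
    LinearMap.ker_comp_of_ker_eq_bot φ (traceForm_nondegenerate L F).ker_eq_bot
  rw [← hker]
  refine even_finrank_add_finrank_ker fun x => ?_
  refine (traceForm_nondegenerate (ZMod 2) L).1 _ fun e => ?_
  obtain ⟨b, rfl⟩ := FiniteField.isSquare_of_char_two (ringChar.eq_iff.mpr inferInstance) e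
  have hb : (b * b) • (φ x * x) = φ (b • x) * (b • x) := by
    rw [map_smul, smul_mul_smul_comm]
  rw [BilinForm.compLeft_apply, Algebra.traceForm_apply, Algebra.traceForm_apply, mul_comm,
    ← smul_eq_mul, ← map_smul, hb, Algebra.trace_trace, hφ]

end AlternatingForm

section TraceForm

variable {F : Type*} [Field F] [Algebra (ZMod 2) F]

/-- The quadratic form `x ↦ Tr(θ α x c(x) + β x s(x))` over the prime field. It encodes the
exponent of `T(α, β)` when `c` is the involution fixing `K`, `s` is `x ↦ x ^ 2 ^ k` and `θ` has
relative trace `θ + c(θ) = 1`: then `Tr_F(θ a) = Tr_K(a)` for every `a` in `K`. -/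
noncomputable def quad (s c : F ≃ₐ[ZMod 2] F) (θ α β : F) : QuadraticForm (ZMod 2) F :=
  ((Algebra.traceForm (ZMod 2) F).compRight
    (LinearMap.mulLeft _ (θ * α) ∘ₗ c.toLinearMap +
      LinearMap.mulLeft _ β ∘ₗ s.toLinearMap)).toQuadraticMap

theorem quad_apply (s c : F ≃ₐ[ZMod 2] F) (θ α β x : F) :
    quad s c θ α β x = Algebra.trace (ZMod 2) F (θ * α * (x * c x) + β * (x * s x)) := by
  change Algebra.trace (ZMod 2) F (x * (θ * α * c x + β * s x)) = _
  ring_nf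

/-- The linearized polynomial map `x ↦ α c(x) + β s(x) + s⁻¹(β x)`, which represents the polar
form of `quad` with respect to the trace form. -/
noncomputable def polarMap (s c : F ≃ₐ[ZMod 2] F) (α β : F) : F →ₗ[ZMod 2] F :=
  LinearMap.mulLeft _ α ∘ₗ c.toLinearMap + LinearMap.mulLeft _ β ∘ₗ s.toLinearMap +
    s.symm.toLinearMap ∘ₗ LinearMap.mulLeft _ β

theorem polarMap_apply (s c : F ≃ₐ[ZMod 2] F) (α β x : F) :
    polarMap s c α β x = α * c x + β * s x + s.symm (β * x) := rfl

variable {s c : F ≃ₐ[ZMod 2] F} {θ α β : F}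

theorem trace_mul_add_conj (hc : Function.Involutive c) (hθ : θ + c θ = 1) (hα : c α = α) (z : F) :
    Algebra.trace (ZMod 2) F (θ * α * (z + c z)) = Algebra.trace (ZMod 2) F (α * z) := by
  have h : Algebra.trace (ZMod 2) F (θ * α * c z) = Algebra.trace (ZMod 2) F (c θ * α * z) := by
    rw [← Algebra.trace_eq_of_algEquiv c]
    simp only [map_mul, hc _, hα]
  rw [mul_add, map_add, h, ← map_add]
  congr 1
  linear_combination α * z * hθ

theorem polarBilin_quad_apply (hc : Function.Involutive c) (hθ : θ + c θ = 1) (hα : c α = α)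
    (x y : F) :
    (quad s c θ α β).polarBilin x y = Algebra.trace (ZMod 2) F (polarMap s c α β x * y) := by
  have hβ : Algebra.trace (ZMod 2) F (s.symm (β * x) * y) =
      Algebra.trace (ZMod 2) F (β * x * s y) := by
    rw [← Algebra.trace_eq_of_algEquiv s, map_mul, AlgEquiv.apply_symm_apply]
  have hpolar : Algebra.trace (ZMod 2) F (polarMap s c α β x * y) = Algebra.trace (ZMod 2) F
      (θ * α * (y * c x + c (y * c x)) + β * s x * y + β * x * s y) := by
    rw [polarMap_apply, add_mul, add_mul, map_add, hβ, map_add, map_add, map_add,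
      trace_mul_add_conj hc hθ hα, mul_assoc α, mul_comm y]
  rw [QuadraticMap.polarBilin_apply_apply, QuadraticMap.polar, hpolar]
  simp only [quad_apply, ← map_sub]
  congr 1
  simp only [map_add, map_mul, hc _]
  ring

theorem ker_polarBilin_quad [Finite F] (hc : Function.Involutive c) (hθ : θ + c θ = 1)
    (hα : c α = α) : ker (quad s c θ α β).polarBilin = ker (polarMap s c α β) := by
  have h : (quad s c θ α β).polarBilin =
      (Algebra.traceForm (ZMod 2) F).compLeft (polarMap s c α β) :=
    LinearMap.ext₂ fun x y => polarBilin_quad_apply hc hθ hα x y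
  rw [h]
  exact LinearMap.ker_comp_of_ker_eq_bot _ (traceForm_nondegenerate (ZMod 2) F).ker_eq_bot

theorem trace_polarMap_mul_self (hc : Function.Involutive c) (hθ : θ + c θ = 1) (hα : c α = α)
    (x : F) : Algebra.trace (ZMod 2) F (polarMap s c α β x * x) = 0 := by
  rw [← polarBilin_quad_apply hc hθ hα, QuadraticMap.polarBilin_apply_apply,
    QuadraticMap.polar_self, two_smul, CharTwo.add_self_eq_zero]

theorem polarMap_smul {e : F} (hs : s e = e) (hce : c e = e) (x : F) :
    polarMap s c α β (e * x) = e * polarMap s c α β x := by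
  have h : s.symm e = e := by rw [AlgEquiv.symm_apply_eq, hs]
  simp only [polarMap_apply, map_mul, hs, hce, h]
  ring

theorem exists_card_mul_card_ker_polarMap_eq [Finite F] (hc : Function.Involutive c)
    (hθ : θ + c θ = 1) (hα : c α = α) {L : IntermediateField (ZMod 2) F}
    (hL : ∀ e ∈ L, s e = e ∧ c e = e) :
    ∃ j : ℕ, Nat.card F * Nat.card (ker (polarMap s c α β)) = Nat.card L ^ (2 * j) := by
  let φ : F →ₗ[L] F :=
    { polarMap s c α β with
      map_smul' := fun e x => polarMap_smul (hL e e.2).1 (hL e e.2).2 x }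
  obtain ⟨j, hj⟩ : Even (Module.finrank L F + Module.finrank L (ker φ)) :=
    even_finrank_add_finrank_ker_of_trace_self (trace_polarMap_mul_self hc hθ hα)
  refine ⟨j, ?_⟩
  have hker : Nat.card (ker (polarMap s c α β)) = Nat.card (ker φ) := rfl
  rw [hker, Module.natCard_eq_pow_finrank (K := L) (V := F),
    Module.natCard_eq_pow_finrank (K := L) (V := ker φ), ← pow_add, hj, two_mul]

end TraceForm

section FixedField

variable {k F : Type*} [Field k] [Field F] [Algebra k F]

/-- The field of elements fixed by an automorphism. -/
def fixedBy (σ : F ≃ₐ[k] F) : IntermediateField k F :=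
  IntermediateField.fixedField (Subgroup.zpowers σ)

theorem mem_fixedBy {σ : F ≃ₐ[k] F} {x : F} : x ∈ fixedBy σ ↔ σ x = x := by
  rw [fixedBy, IntermediateField.mem_fixedField_iff]
  exact Subgroup.zpowers_le (H := MulAction.stabilizer (F ≃ₐ[k] F) x)

theorem fixedBy_pow_inf_fixedBy_pow (σ : F ≃ₐ[k] F) (i j : ℕ) :
    fixedBy (σ ^ i) ⊓ fixedBy (σ ^ j) = fixedBy (σ ^ i.gcd j) := by
  have h (l : ℕ) (x : F) : x ∈ fixedBy (σ ^ l) ↔ Function.IsPeriodicPt σ l x := by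
    rw [mem_fixedBy, AlgEquiv.coe_pow]
    rfl
  ext x
  rw [IntermediateField.mem_inf, h, h, h]
  exact ⟨fun hx => hx.1.gcd hx.2,
    fun hx => ⟨hx.trans_dvd (Nat.gcd_dvd_left i j), hx.trans_dvd (Nat.gcd_dvd_right i j)⟩⟩

theorem natCard_fixedBy_frobenius_pow [Fintype k] [Finite F] (j : ℕ) :
    Nat.card (fixedBy (FiniteField.frobeniusAlgEquivOfAlgebraic k F ^ j)) =
      Nat.card k ^ (Module.finrank k F).gcd j := by
  set σ := FiniteField.frobeniusAlgEquivOfAlgebraic k F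
  have hpos : 0 < Module.finrank k F := Module.finrank_pos
  have hfix : Module.finrank (fixedBy (σ ^ j)) F =
      Module.finrank k F / (Module.finrank k F).gcd j := by
    rw [fixedBy, IntermediateField.finrank_fixedField_eq_card, Nat.card_zpowers, orderOf_pow,
      FiniteField.orderOf_frobeniusAlgEquivOfAlgebraic]
  have hmul := Module.finrank_mul_finrank k (fixedBy (σ ^ j)) F
  have hgcd := Nat.div_mul_cancel (Nat.gcd_dvd_left (Module.finrank k F) j)
  rw [hfix] at hmul
  rw [Module.natCard_eq_pow_finrank (K := k)]
  congr 1
  refine Nat.eq_of_mul_eq_mul_right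
    (Nat.div_pos (Nat.gcd_le_left j hpos) (Nat.gcd_pos_of_pos_left j hpos)) ?_
  rw [hmul, mul_comm, hgcd]

end FixedField

section Radical

variable {F : Type*} [Field F] [Algebra (ZMod 2) F] {s c : F ≃ₐ[ZMod 2] F} {α β x : F}

/-- The map `y ↦ β x s(y) + c(β s(x) y)`. On the radical of `quad` it takes values in the field
fixed by `s ∘ c`, and its kernel is at most one-dimensional over that field. -/
noncomputable def pairing (s c : F ≃ₐ[ZMod 2] F) (β x : F) : F →ₗ[ZMod 2] F :=
  LinearMap.mulLeft _ (β * x) ∘ₗ s.toLinearMap +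
    c.toLinearMap ∘ₗ LinearMap.mulLeft _ (β * s x)

theorem pairing_apply (s c : F ≃ₐ[ZMod 2] F) (β x y : F) :
    pairing s c β x y = β * x * s y + c (β * s x * y) := rfl

theorem pairing_mem_fixedBy (hc : Function.Involutive c) (hsc : Function.Commute s c)
    (hα : c α = α) {y : F} (hx : polarMap s c α β x = 0) (hy : polarMap s c α β y = 0) :
    pairing s c β x y ∈ fixedBy (s * c) := by
  have hx' := congrArg (fun t => c (s (c t))) hx
  have hy' := congrArg (fun t => c (s t)) hy
  simp only [polarMap_apply, map_add, map_mul, map_zero, hsc _, hc _, hα,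
    AlgEquiv.apply_symm_apply] at hx' hy'
  rw [mem_fixedBy, AlgEquiv.mul_apply, pairing_apply]
  simp only [map_add, map_mul, hsc _, hc _]
  linear_combination s y * hx' + c (s x) * hy'
    - (c (s α) * s y * c (s x) + β * x * s y + c β * c (s x) * c y) * CharTwo.two_eq_zero (R := F)

theorem div_mem_fixedBy_of_pairing_eq_zero (hc : Function.Involutive c)
    (hsc : Function.Commute s c) (hβ : β ≠ 0) (hx : x ≠ 0) {y z : F} (hy0 : y ≠ 0)
    (hy : pairing s c β x y = 0) (hz : pairing s c β x z = 0) : z / y ∈ fixedBy (s * c) := by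
  rw [pairing_apply, CharTwo.add_eq_zero, map_mul] at hy hz
  have hdiv : s (z / y) = c (z / y) := by
    rw [map_div₀, map_div₀, div_eq_div_iff (by simpa using hy0) (by simpa using hy0)]
    apply mul_left_cancel₀ (mul_ne_zero hβ hx)
    linear_combination c y * hz - c z * hy
  rw [mem_fixedBy, AlgEquiv.mul_apply, hsc, hdiv, hc]

theorem card_ker_pairing_le [Finite F] (hc : Function.Involutive c) (hsc : Function.Commute s c)
    (hβ : β ≠ 0) (hx : x ≠ 0) :
    Nat.card (ker (pairing s c β x)) ≤ Nat.card (fixedBy (s * c)) := by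
  rcases eq_or_ne (ker (pairing s c β x)) ⊥ with h | h
  · rw [h, Nat.card_unique]
    exact Nat.card_pos
  · obtain ⟨y, hy, hy0⟩ := Submodule.exists_mem_ne_zero_of_ne_bot h
    refine Nat.card_le_card_of_injective
      (fun z => ⟨(z : F) / y, div_mem_fixedBy_of_pairing_eq_zero hc hsc hβ hx hy0 hy z.2⟩)
      fun z z' hzz' => Subtype.ext ((div_left_inj' hy0).mp (congrArg Subtype.val hzz'))

theorem card_ker_polarMap_le [Finite F] (hc : Function.Involutive c) (hsc : Function.Commute s c)
    (hα : c α = α) (hβ : β ≠ 0) :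
    Nat.card (ker (polarMap s c α β)) ≤ Nat.card (fixedBy (s * c)) ^ 2 := by
  rcases eq_or_ne (ker (polarMap s c α β)) ⊥ with h | h
  · rw [h, Nat.card_unique]
    exact Nat.one_le_pow _ _ Nat.card_pos
  · obtain ⟨x, hx, hx0⟩ := Submodule.exists_mem_ne_zero_of_ne_bot h
    let p := (pairing s c β x).domRestrict (ker (polarMap s c α β))
    have hrange : Nat.card p.range ≤ Nat.card (fixedBy (s * c)) := by
      refine Nat.card_mono (Set.toFinite (fixedBy (s * c) : Set F)) ?_
      rintro _ ⟨y, rfl⟩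
      exact pairing_mem_fixedBy hc hsc hα hx y.2
    have hker : Nat.card (ker p) ≤ Nat.card (fixedBy (s * c)) :=
      (Nat.card_le_card_of_injective
        (fun z : ker p => (⟨z, z.2⟩ : ker (pairing s c β x)))
        fun z z' h => Subtype.ext (Subtype.ext
          (congrArg (Subtype.val : ker (pairing s c β x) → F) h))).trans
          (card_ker_pairing_le hc hsc hβ hx0)
    calc Nat.card (ker (polarMap s c α β))
        = Nat.card (ker p) * Nat.card p.range := by
          have h := Submodule.card_eq_card_quotient_mul_card (ker p)
          rw [Nat.card_congr p.quotKerEquivRange.toEquiv] at h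
          rw [h, mul_comm]
      _ ≤ _ := by
          rw [sq]
          exact Nat.mul_le_mul hker hrange

end Radical

section GroupSums

theorem natCard_dvd_sum_of_mul_mem {G : Type*} [Group G] [Fintype G] (H : Subgroup G) (f : G → ℤ)
    (hf : ∀ x, ∀ h ∈ H, f (x * h) = f x) : (Nat.card H : ℤ) ∣ ∑ x, f x := by
  classical
  rw [← Finset.sum_fiberwise _ (QuotientGroup.mk : G → G ⧸ H) f]
  refine Finset.dvd_sum fun q _ => ⟨f q.out, ?_⟩
  have hcard : Finset.card {x : G | (x : G ⧸ H) = q} = Nat.card H := by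
    rw [← mul_one (Nat.card H), ← Nat.card_unique (α := ({q} : Set (G ⧸ H))),
      ← QuotientGroup.card_preimage_mk, Nat.card_coe_set_eq, ← Set.ncard_coe_finset]
    simp only [Finset.coe_filter, Finset.mem_univ, true_and]
    rfl
  rw [← hcard, ← nsmul_eq_mul, ← Finset.sum_const]
  refine Finset.sum_congr rfl fun x hx => ?_
  have hmem : q.out⁻¹ * x ∈ H := by
    rw [← QuotientGroup.eq, QuotientGroup.out_eq', (Finset.mem_filter.mp hx).2]
  rw [← hf q.out _ hmem, mul_inv_cancel_left]

theorem sum_eq_add_sum_units {F M : Type*} [Field F] [Fintype F] [Fintype Fˣ] [AddCommMonoid M]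
    (f : F → M) : ∑ x, f x = f 0 + ∑ u : Fˣ, f u := by
  classical
  rw [← Finset.add_sum_erase _ _ (Finset.mem_univ 0),
    Finset.sum_subtype (p := fun x : F => x ≠ 0) _ (by simp), ← Equiv.sum_comp unitsEquivNeZero]
  rfl

theorem dvd_sum_sub_of_forall_pow_eq_one {F : Type*} [Field F] [Fintype F] {r : ℕ}
    (hr : r ∣ Fintype.card F - 1) (f : F → ℤ) (hf : ∀ x t : F, t ^ r = 1 → f (x * t) = f x) :
    (r : ℤ) ∣ ∑ x, f x - f 0 := by
  classical
  have hcard : Nat.card (powMonoidHom r : Fˣ →* Fˣ).ker = r := by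
    rw [IsCyclic.card_powMonoidHom_ker, Nat.card_eq_fintype_card, Fintype.card_units,
      Nat.gcd_eq_right hr]
  have h := natCard_dvd_sum_of_mul_mem (powMonoidHom r : Fˣ →* Fˣ).ker (fun u => f u)
    fun x t ht => hf x t <| by
      rw [← Units.val_pow_eq_pow_val, ← powMonoidHom_apply, ht, Units.val_one]
  rwa [hcard, ← add_sub_cancel_left (f 0) (∑ u : Fˣ, f u), ← sum_eq_add_sum_units] at h

theorem sum_comp_eq_card_ker_mul_sum_range {R V W : Type*} [Ring R] [AddCommGroup V] [Module R V]
    [Fintype V] [AddCommGroup W] [Module R W] (f : V →ₗ[R] W) [Fintype (LinearMap.range f)]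
    (g : W → ℤ) :
    ∑ x, g (f x) = Nat.card (ker f) * ∑ y : LinearMap.range f, g y := by
  classical
  have hfiber (y : LinearMap.range f) :
      ({x | f.rangeRestrict x = y} : Finset V).card = Nat.card (ker f) := by
    rw [Nat.card_eq_fintype_card, Fintype.card_subtype]
    have h := AddMonoidHom.card_fiber_eq_of_mem_range f.rangeRestrict.toAddMonoidHom
      (f.surjective_rangeRestrict y) (zero_mem (AddMonoidHom.range _))
    refine h.trans ?_
    congr! 3 with x
    exact Subtype.ext_iff
  refine (Finset.sum_fiberwise' _ f.rangeRestrict fun y => g y).symm.trans ?_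
  rw [Finset.mul_sum]
  refine Finset.sum_congr rfl fun y _ => ?_
  rw [Finset.sum_const, hfiber, nsmul_eq_mul]

end GroupSums

section SignOfSum

variable {F : Type*} [Field F] [Algebra (ZMod 2) F] {s c : F ≃ₐ[ZMod 2] F} {θ α β γ x : F}

theorem trace_eq_zero_of_conj_eq (hc : Function.Involutive c) (hθ : θ + c θ = 1) {a : F}
    (ha : c a = a) : Algebra.trace (ZMod 2) F a = 0 := by
  have h := trace_mul_add_conj hc hθ (map_one c) a
  rwa [ha, CharTwo.add_self_eq_zero, mul_zero, map_zero, one_mul, eq_comm] at h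

theorem trace_mul_map_eq (hc : Function.Involutive c) (hsc : Function.Commute s c)
    (hθ : θ + c θ = 1) {a : F} (ha : c a = a) :
    Algebra.trace (ZMod 2) F (θ * s a) = Algebra.trace (ZMod 2) F (θ * a) := by
  have hsθ : s θ + c (s θ) = 1 := by rw [← hsc, ← map_add, hθ, map_one]
  have hfix : c ((s θ - θ) * s a) = (s θ - θ) * s a := by
    rw [map_mul, ← hsc a, ha, map_sub]
    linear_combination s a * (hsθ - hθ) + s a * (θ - s θ) * CharTwo.two_eq_zero (R := F)
  have h := trace_eq_zero_of_conj_eq hc hθ hfix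
  rw [sub_mul, map_sub, sub_eq_zero] at h
  rw [← h, ← map_mul, Algebra.trace_eq_of_algEquiv]

theorem mul_polarMap_apply (s c : F ≃ₐ[ZMod 2] F) (α β x : F) :
    x * polarMap s c α β x = α * (x * c x) + (β * x * s x + s.symm (β * x * s x)) := by
  rw [polarMap_apply, map_mul s.symm (β * x), AlgEquiv.symm_apply_apply]
  ring

theorem polarMap_eq_zero_iff (hx : x ≠ 0) :
    polarMap s c α β x = 0 ↔ α * (x * c x) = β * x * s x + s.symm (β * x * s x) := by
  rw [← CharTwo.add_eq_zero (a := α * _), ← mul_polarMap_apply, mul_eq_zero_iff_left hx]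

theorem mul_conj_eq_of_polarMap_eq_zero (hx : polarMap s c α β x = 0) :
    α * (x * c x) = β * x * s x + s.symm (β * x * s x) := by
  rw [← CharTwo.add_eq_zero, ← mul_polarMap_apply, hx, mul_zero]

theorem quad_mul_of_polarMap_eq_zero (hc : Function.Involutive c) (hsc : Function.Commute s c)
    (hθ : θ + c θ = 1) (hx : polarMap s c α β x = 0) (hγ : c (β * x * s x) = β * x * s x) (y : F) :
    quad s c θ α β (x * y) = quad s c θ (β * x * s x) 0 (y + s (c y)) := by
  have hα := mul_conj_eq_of_polarMap_eq_zero hx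
  have hxx : β * (x * y * s (x * y)) = β * x * s x * (y * s y) := by
    rw [map_mul]
    ring
  generalize β * x * s x = γ at *
  have hγs : Algebra.trace (ZMod 2) F (θ * (s.symm γ * (y * c y))) =
      Algebra.trace (ZMod 2) F (θ * (γ * (s y * s (c y)))) := by
    rw [← trace_mul_map_eq hc hsc hθ]
    · simp only [map_mul, AlgEquiv.apply_symm_apply]
    · have hγ' : c (s.symm γ) = s.symm γ := by
        rw [AlgEquiv.eq_symm_apply, hsc, AlgEquiv.apply_symm_apply, hγ]
      rw [map_mul, map_mul, hγ', hc, mul_comm (c y)]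
  have hαy : θ * α * (x * y * c (x * y)) =
      θ * (γ * (y * c y)) + θ * (s.symm γ * (y * c y)) := by
    rw [map_mul]
    linear_combination θ * (y * c y) * hα
  rw [quad_apply, quad_apply, hxx, hαy, map_add, map_add, hγs,
    ← trace_mul_add_conj hc hθ hγ (y * s y), ← map_add, ← map_add]
  congr 1
  simp only [map_add, map_mul, hsc _, hc _]
  ring

theorem trace_mul_add_map (σ : F ≃ₐ[ZMod 2] F) (e y : F) :
    Algebra.trace (ZMod 2) F (e * (y + σ y)) = Algebra.trace (ZMod 2) F ((e + σ.symm e) * y) := by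
  have h : Algebra.trace (ZMod 2) F (e * σ y) = Algebra.trace (ZMod 2) F (σ.symm e * y) := by
    rw [← Algebra.trace_eq_of_algEquiv σ.symm, map_mul σ.symm, AlgEquiv.symm_apply_apply]
  rw [mul_add, add_mul, map_add, map_add, h]

theorem mul_conj_mem_fixedBy_of_mem_orthogonal [Finite F] (hc : Function.Involutive c)
    (hθ : θ + c θ = 1) (hγ : c γ = γ) {σ : F ≃ₐ[ZMod 2] F} {u : F}
    (hu : u ∈ BilinForm.orthogonal (quad s c θ γ 0).polarBilin
      (LinearMap.range (LinearMap.id + σ.toLinearMap))) :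
    γ * c u ∈ fixedBy σ := by
  rw [mem_fixedBy, ← AlgEquiv.eq_symm_apply, ← CharTwo.add_eq_zero]
  refine (traceForm_nondegenerate (ZMod 2) F).1 _ fun y => ?_
  have h : (quad s c θ γ 0).polarBilin (y + σ y) u = 0 := hu _ ⟨y, rfl⟩
  rw [polarBilin_quad_apply hc hθ hγ, ← Algebra.trace_eq_of_algEquiv c] at h
  simp only [polarMap_apply, map_add, map_mul, hγ, hc _, zero_mul, map_zero, add_zero] at h
  rw [Algebra.traceForm_apply, ← trace_mul_add_map, ← h]
  congr 1
  ring

theorem orthogonal_range_isotropic [Finite F] (hc : Function.Involutive c) (hθ : θ + c θ = 1)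
    (hγ : c γ = γ) (hγ0 : γ ≠ 0) {σ : F ≃ₐ[ZMod 2] F} (hσ : fixedBy σ ≤ fixedBy c) :
    BilinForm.orthogonal (quad s c θ γ 0).polarBilin
        (LinearMap.range (LinearMap.id + σ.toLinearMap)) ≤
      BilinForm.orthogonal (quad s c θ γ 0).polarBilin
        (BilinForm.orthogonal (quad s c θ γ 0).polarBilin
          (LinearMap.range (LinearMap.id + σ.toLinearMap))) := by
  have hfix {u : F} (hu : u ∈ BilinForm.orthogonal (quad s c θ γ 0).polarBilin
      (LinearMap.range (LinearMap.id + σ.toLinearMap))) : c u = u := by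
    have h := mem_fixedBy.mp (hσ (mul_conj_mem_fixedBy_of_mem_orthogonal hc hθ hγ hu))
    rw [map_mul, hγ, hc] at h
    exact (mul_left_cancel₀ hγ0 h).symm
  intro u hu v hv
  refine (polarBilin_quad_apply hc hθ hγ v u).trans (trace_eq_zero_of_conj_eq hc hθ ?_)
  simp only [polarMap_apply, map_mul, map_zero, zero_mul, add_zero, hγ, hfix hu, hfix hv]

theorem ker_polarMap_zero_right (hα : α ≠ 0) : ker (polarMap s c α 0) = ⊥ := by
  refine (Submodule.eq_bot_iff _).mpr fun x hx => ?_
  have h : polarMap s c α 0 x = 0 := hx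
  simpa [polarMap_apply, hα] using h

theorem conj_involutive_of_pow [Fintype F] {N : ℕ} (hF : Fintype.card F = N ^ 2)
    (hcN : ∀ x, c x = x ^ N) : Function.Involutive c := fun x => by
  rw [hcN, hcN, ← pow_mul, ← sq, ← hF, FiniteField.pow_card]

/-- The form is constant on orbits of the `N + 1` elements of norm one, so the sum is `1` modulo
`N + 1`, which rules out `N`. -/
theorem expSum_quad_zero_right [Fintype F] {N : ℕ} (hF : Fintype.card F = N ^ 2)
    (hcN : ∀ x, c x = x ^ N) (hθ : θ + c θ = 1) (hγ : c γ = γ) (hγ0 : γ ≠ 0) :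
    expSum (quad s c θ γ 0) = -N := by
  have hc := conj_involutive_of_pow hF hcN
  have hN : 1 < N := (one_lt_sq_iff₀ N.zero_le).mp (hF ▸ Fintype.one_lt_card)
  have hsq : expSum (quad s c θ γ 0) ^ 2 = (N : ℤ) ^ 2 := by
    rw [expSum_sq_of_ker_polarBilin_eq_bot, hF, Nat.cast_pow]
    rw [ker_polarBilin_quad hc hθ hγ, ker_polarMap_zero_right hγ0]
  refine (sq_eq_sq_iff_eq_or_eq_neg.mp hsq).resolve_left fun hpos => ?_
  have hdvd : ((N + 1 : ℕ) : ℤ) ∣ expSum (quad s c θ γ 0) - 1 := by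
    have h := dvd_sum_sub_of_forall_pow_eq_one (r := N + 1)
      (by rw [hF]; exact ⟨N - 1, by simpa using Nat.sq_sub_sq N 1⟩)
      (fun x => sgn (quad s c θ γ 0 x)) fun x t ht => by
        have htt : t * c t = 1 := by rw [hcN, ← pow_succ', ht]
        rw [quad_apply, quad_apply]
        congr 2
        rw [map_mul]
        linear_combination θ * γ * x * c x * htt
    rwa [QuadraticMap.map_zero, AddChar.map_zero_eq_one] at h
  rw [hpos] at hdvd
  have := Int.le_of_dvd (by omega) hdvd
  omega

theorem expSum_quad_eq_zero_or_eq_neg [Fintype F] {N : ℕ} (hF : Fintype.card F = N ^ 2)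
    (hcN : ∀ x, c x = x ^ N) (hsc : Function.Commute s c) (hθ : θ + c θ = 1)
    (hE : fixedBy (s * c) ≤ fixedBy c) (hβ : β ≠ 0) (hx0 : x ≠ 0)
    (hx : polarMap s c α β x = 0) (hγ : c (β * x * s x) = β * x * s x) :
    expSum (quad s c θ α β) = 0 ∨
      expSum (quad s c θ α β) = -(N * Nat.card (fixedBy (s * c))) := by
  classical
  have hc := conj_involutive_of_pow hF hcN
  have hγ0 : β * x * s x ≠ 0 := mul_ne_zero (mul_ne_zero hβ hx0) (by simpa using hx0)
  let Q := quad s c θ (β * x * s x) 0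
  let ψ : F →ₗ[ZMod 2] F := LinearMap.id + (s * c).toLinearMap
  have hker : Nat.card (ker ψ) = Nat.card (fixedBy (s * c)) :=
    Nat.card_congr (Equiv.subtypeEquivRight fun y => by
      rw [mem_fixedBy, eq_comm, ← CharTwo.add_eq_zero]
      rfl)
  have hQ : ker Q.polarBilin = ⊥ := by
    rw [ker_polarBilin_quad hc hθ hγ, ker_polarMap_zero_right hγ0]
  have hrefl : Q.polarBilin.IsRefl := fun y z h => (QuadraticMap.polar_comm Q z y).trans h
  have hperp : BilinForm.orthogonal Q.polarBilin
      (BilinForm.orthogonal Q.polarBilin (LinearMap.range ψ)) = LinearMap.range ψ :=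
    BilinForm.orthogonal_orthogonal (hrefl.nondegenerate_iff_separatingLeft.mpr
      (LinearMap.separatingLeft_iff_ker_eq_bot.mpr hQ)) hrefl _
  have hsum : expSum (quad s c θ α β) =
      Nat.card (fixedBy (s * c)) * ∑ z : LinearMap.range ψ, sgn (Q z) := by
    rw [← hker, ← sum_comp_eq_card_ker_mul_sum_range ψ fun z => sgn (Q z), expSum,
      ← Equiv.sum_comp (Equiv.mulLeft₀ x hx0)]
    exact Finset.sum_congr rfl fun y _ =>
      congrArg sgn (quad_mul_of_polarMap_eq_zero hc hsc hθ hx hγ y)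
  have hrange : ∑ z : LinearMap.range ψ, sgn (Q z) = ∑ z : BilinForm.orthogonal Q.polarBilin
      (BilinForm.orthogonal Q.polarBilin (LinearMap.range ψ)), sgn (Q z) :=
    Fintype.sum_equiv (LinearEquiv.ofEq _ _ hperp.symm).toEquiv _ _ fun _ => rfl
  have h := sum_orthogonal_eq_zero_or_eq_expSum Q _ (orthogonal_range_isotropic hc hθ hγ hγ0 hE)
  rw [← hrange, expSum_quad_zero_right hF hcN hθ hγ hγ0] at h
  rw [hsum]
  rcases h with h | h <;> rw [h]
  · exact Or.inl (mul_zero _)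
  · exact Or.inr (by ring)

end SignOfSum

section Moments

variable {F : Type*} [Field F] [Algebra (ZMod 2) F] {s c : F ≃ₐ[ZMod 2] F} {θ : F}

open scoped Classical in
theorem sum_sgn_trace_pair [Fintype F] [Fintype (fixedBy c)] (hc : Function.Involutive c)
    (hθ : θ + c θ = 1) {u : F} (hu : c u = u) (v : F) :
    ∑ p : fixedBy c × F, sgn (Algebra.trace (ZMod 2) F (θ * p.1 * u + p.2 * v)) =
      if u = 0 ∧ v = 0 then (Fintype.card (fixedBy c × F) : ℤ) else 0 := by
  let f : fixedBy c × F →+ ZMod 2 :=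
    { toFun := fun p => Algebra.trace (ZMod 2) F (θ * p.1 * u + p.2 * v)
      map_zero' := by simp
      map_add' := fun p p' => by
        rw [← map_add]
        congr 1
        simp only [Prod.fst_add, Prod.snd_add, IntermediateField.coe_add]
        ring }
  have hf : (∀ p, f p = 0) ↔ u = 0 ∧ v = 0 := by
    refine ⟨fun h => ⟨?_, ?_⟩, fun ⟨hu, hv⟩ p => by simp [f, hu, hv]⟩
    · refine (traceForm_nondegenerate (ZMod 2) F).1 _ fun w => ?_
      have hw := h (⟨w + c w, by rw [mem_fixedBy, map_add, hc, add_comm]⟩, 0)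
      simp only [f, AddMonoidHom.coe_mk, ZeroHom.coe_mk, zero_mul, add_zero] at hw
      rwa [mul_right_comm, trace_mul_add_conj hc hθ hu] at hw
    · refine (traceForm_nondegenerate (ZMod 2) F).1 _ fun w => ?_
      simpa [f, mul_comm] using h (0, w)
  exact (sum_sgn_addMonoidHom f).trans (if_congr hf rfl rfl)

theorem sum_expSum_quad [Fintype F] [Fintype (fixedBy c)] (hc : Function.Involutive c)
    (hθ : θ + c θ = 1) :
    ∑ p : fixedBy c × F, expSum (quad s c θ p.1 p.2) = Fintype.card (fixedBy c × F) := by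
  classical
  have h (x : F) : ∑ p : fixedBy c × F, sgn (quad s c θ p.1 p.2 x) =
      if x = 0 then (Fintype.card (fixedBy c × F) : ℤ) else 0 := by
    simp only [quad_apply]
    rw [sum_sgn_trace_pair hc hθ (by rw [map_mul, hc, mul_comm])]
    simp
  simp only [expSum]
  rw [Finset.sum_comm]
  simp only [h, Finset.sum_ite_eq', Finset.mem_univ, if_true]

theorem eq_of_mul_conj_eq (hc : Function.Involutive c) (hsc : Function.Commute s c)
    (hE : fixedBy (s * c) ≤ fixedBy c) {x y : F} (hN : x * c x = y * c y)
    (hs : x * s x = y * s y) : x = y := by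
  rcases eq_or_ne y 0 with rfl | hy
  · simpa using hN
  obtain ⟨t, rfl⟩ : ∃ t, x = t * y := ⟨x / y, (div_mul_cancel₀ x hy).symm⟩
  have hcy : c y ≠ 0 := by simpa using hy
  have hsy : s y ≠ 0 := by simpa using hy
  have htc : t * c t = 1 := by
    apply mul_right_cancel₀ (mul_ne_zero hy hcy)
    rw [map_mul] at hN
    linear_combination hN
  have hts : t * s t = 1 := by
    apply mul_right_cancel₀ (mul_ne_zero hy hsy)
    rw [map_mul] at hs
    linear_combination hs
  have hst : s t = c t := mul_left_cancel₀ (left_ne_zero_of_mul_eq_one htc) (hts.trans htc.symm)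
  have htE : t ∈ fixedBy (s * c) := by rw [mem_fixedBy, AlgEquiv.mul_apply, hsc, hst, hc]
  rw [mem_fixedBy.mp (hE htE), mul_self_eq_one_iff, CharTwo.neg_eq, or_self] at htc
  rw [htc, one_mul]

theorem sum_expSum_quad_sq [Fintype F] [Fintype (fixedBy c)] (hc : Function.Involutive c)
    (hsc : Function.Commute s c) (hθ : θ + c θ = 1) (hE : fixedBy (s * c) ≤ fixedBy c) :
    ∑ p : fixedBy c × F, expSum (quad s c θ p.1 p.2) ^ 2 =
      Fintype.card (fixedBy c × F) * Fintype.card F := by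
  classical
  have h (x y : F) :
      ∑ p : fixedBy c × F, sgn (quad s c θ p.1 p.2 x) * sgn (quad s c θ p.1 p.2 y) =
        if x = y then (Fintype.card (fixedBy c × F) : ℤ) else 0 := by
    have hfix : c (x * c x + y * c y) = x * c x + y * c y := by
      simp only [map_add, map_mul, hc _, mul_comm]
    have hxy : x * c x + y * c y = 0 ∧ x * s x + y * s y = 0 ↔ x = y := by
      rw [CharTwo.add_eq_zero, CharTwo.add_eq_zero]
      exact ⟨fun ⟨hN, hs⟩ => eq_of_mul_conj_eq hc hsc hE hN hs, by rintro rfl; simp⟩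
    simp only [← hxy, ← sum_sgn_trace_pair hc hθ hfix, quad_apply, ← AddChar.map_add_eq_mul,
      ← map_add]
    refine Finset.sum_congr rfl fun p _ => ?_
    congr 2
    ring
  simp only [expSum, sq, Finset.sum_mul_sum]
  rw [Finset.sum_comm_cycle, Finset.sum_comm_cycle]
  simp only [h, Finset.sum_ite_eq, Finset.mem_univ, if_true, Finset.sum_const,
    Finset.card_univ, nsmul_eq_mul, mul_comm]

theorem natCard_add_conj_mem_fixedBy (hc : Function.Involutive c) (hθ : θ + c θ = 1) :
    Nat.card {u : F // u + c u ∈ fixedBy s} =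
      Nat.card (fixedBy c) * Nat.card (fixedBy s ⊓ fixedBy c : IntermediateField (ZMod 2) F) := by
  have hcθ : c θ = 1 + θ := by linear_combination hθ - θ * CharTwo.two_eq_zero (R := F)
  have hconj (u : F) : c (u + c u) = u + c u := by rw [map_add, hc, add_comm]
  have hfst (u : F) : c (u + θ * (u + c u)) = u + θ * (u + c u) := by
    rw [map_add, map_mul, hconj, hcθ]
    linear_combination c u * CharTwo.two_eq_zero (R := F)
  have hsnd {a w : F} (ha : c a = a) (hw : c w = w) : a + θ * w + c (a + θ * w) = w := by
    rw [map_add, map_mul, ha, hw, hcθ]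
    linear_combination (a + θ * w) * CharTwo.two_eq_zero (R := F)
  rw [← Nat.card_prod]
  refine Nat.card_congr
    { toFun := fun u => (⟨u + θ * (u + c u), mem_fixedBy.mpr (hfst u)⟩,
        ⟨u + c u, u.2, mem_fixedBy.mpr (hconj u)⟩)
      invFun := fun p => ⟨p.1 + θ * p.2, ?_⟩
      left_inv := fun u => Subtype.ext ?_
      right_inv := fun p => Prod.ext (Subtype.ext ?_) (Subtype.ext ?_) }
  · rw [hsnd (mem_fixedBy.mp p.1.2) (mem_fixedBy.mp p.2.2.2)]
    exact p.2.2.1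
  · linear_combination θ * (u + c u) * CharTwo.two_eq_zero (R := F)
  · change (p.1 : F) + θ * p.2 + θ * (p.1 + θ * p.2 + c (p.1 + θ * p.2)) = p.1
    rw [hsnd (mem_fixedBy.mp p.1.2) (mem_fixedBy.mp p.2.2.2)]
    linear_combination θ * p.2 * CharTwo.two_eq_zero (R := F)
  · exact hsnd (mem_fixedBy.mp p.1.2) (mem_fixedBy.mp p.2.2.2)

theorem natCard_polarMap_eq_zero (hc : Function.Involutive c) (hsc : Function.Commute s c)
    (hθ : θ + c θ = 1) {x : F} (hx : x ≠ 0) :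
    Nat.card {p : fixedBy c × F // polarMap s c p.1 p.2 x = 0} =
      Nat.card (fixedBy c) * Nat.card (fixedBy s ⊓ fixedBy c : IntermediateField (ZMod 2) F) := by
  rw [← natCard_add_conj_mem_fixedBy hc hθ]
  have hxc : x * c x ≠ 0 := mul_ne_zero hx (by simpa using hx)
  have hxs : x * s x ≠ 0 := mul_ne_zero hx (by simpa using hx)
  have hmul (u : F) : u / (x * s x) * x * s x = u := by rw [mul_assoc, div_mul_cancel₀ _ hxs]
  have hxc' : c (x * c x) = x * c x := by rw [map_mul, hc, mul_comm]
  have hfix (u : F) : c (u + s.symm u) = u + s.symm u ↔ u + c u ∈ fixedBy s := by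
    have hcs : c (s.symm u) = s.symm (c u) := by
      rw [AlgEquiv.eq_symm_apply, hsc, AlgEquiv.apply_symm_apply]
    rw [mem_fixedBy, eq_comm (a := s _), ← AlgEquiv.symm_apply_eq, map_add, map_add, hcs]
    constructor <;> intro h
    · linear_combination h + (s.symm u - c u) * CharTwo.two_eq_zero (R := F)
    · linear_combination h + (c u - s.symm u) * CharTwo.two_eq_zero (R := F)
  refine Nat.card_congr
    { toFun := fun p => ⟨p.1.2 * x * s x, (hfix _).mp ?_⟩
      invFun := fun u => ⟨(⟨(u + s.symm u) / (x * c x), ?_⟩, u / (x * s x)), ?_⟩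
      left_inv := fun p => Subtype.ext (Prod.ext (Subtype.ext ?_) ?_)
      right_inv := fun u => Subtype.ext (hmul u) }
  · rw [← (polarMap_eq_zero_iff hx).mp p.2, map_mul, hxc', mem_fixedBy.mp p.1.1.2]
  · rw [mem_fixedBy, map_div₀, hxc', (hfix _).mpr u.2]
  · rw [polarMap_eq_zero_iff hx, div_mul_cancel₀ _ hxc, hmul]
  · change (p.1.2 * x * s x + s.symm (p.1.2 * x * s x)) / (x * c x) = p.1.1
    rw [← (polarMap_eq_zero_iff hx).mp p.2, mul_div_cancel_right₀ _ hxc]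
  · change p.1.2 * x * s x / (x * s x) = p.1.2
    rw [mul_assoc, mul_div_cancel_right₀ _ hxs]

theorem sum_card_ker_polarMap [Fintype F] [Fintype (fixedBy c)] (hc : Function.Involutive c)
    (hsc : Function.Commute s c) (hθ : θ + c θ = 1) :
    ∑ p : fixedBy c × F, Nat.card (ker (polarMap s c p.1 p.2)) =
      Fintype.card (fixedBy c × F) + (Fintype.card F - 1) * (Nat.card (fixedBy c) *
        Nat.card (fixedBy s ⊓ fixedBy c : IntermediateField (ZMod 2) F)) := by
  classical
  have h (p : fixedBy c × F) : Nat.card (ker (polarMap s c p.1 p.2)) =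
      ∑ x : F, if polarMap s c p.1 p.2 x = 0 then 1 else 0 := by
    rw [Finset.sum_boole, Nat.cast_id, ← Fintype.card_subtype, ← Nat.card_eq_fintype_card]
    rfl
  have h' {x : F} (hx : x ∈ Finset.univ.erase 0) :
      (∑ p : fixedBy c × F, if polarMap s c p.1 p.2 x = 0 then 1 else 0) =
        Nat.card (fixedBy c) *
          Nat.card (fixedBy s ⊓ fixedBy c : IntermediateField (ZMod 2) F) := by
    rw [Finset.sum_boole, Nat.cast_id, ← Fintype.card_subtype, ← Nat.card_eq_fintype_card,
      natCard_polarMap_eq_zero hc hsc hθ (Finset.ne_of_mem_erase hx)]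
  simp only [h]
  rw [Finset.sum_comm, ← Finset.add_sum_erase _ _ (Finset.mem_univ 0), Finset.sum_congr rfl
    fun _ => h', Finset.sum_const, Finset.card_erase_of_mem (Finset.mem_univ 0), smul_eq_mul]
  simp

end Moments

section Values

variable {F : Type*} [Field F] [Algebra (ZMod 2) F] {s c : F ≃ₐ[ZMod 2] F} {θ α β : F}
  {Q a b e : ℕ}

/-- By the pigeonhole principle two elements `x`, `y` of the radical have the same `pairing` with
themselves, and then `x + y` works because `c` fixes `pairing x y`. -/
theorem exists_mem_ker_polarMap_conj_eq [Finite F] (hc : Function.Involutive c)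
    (hsc : Function.Commute s c) (hα : c α = α) (hE : fixedBy (s * c) ≤ fixedBy c)
    (h : Nat.card (fixedBy (s * c)) < Nat.card (ker (polarMap s c α β))) :
    ∃ x, x ≠ 0 ∧ polarMap s c α β x = 0 ∧ c (β * x * s x) = β * x * s x := by
  let g (x : ker (polarMap s c α β)) : fixedBy (s * c) :=
    ⟨pairing s c β x x, pairing_mem_fixedBy hc hsc hα x.2 x.2⟩
  have hg : ¬ Function.Injective g := fun hg =>
    h.not_ge (Nat.card_le_card_of_injective g hg)
  simp only [Function.Injective, not_forall] at hg
  obtain ⟨⟨x, hx⟩, ⟨y, hy⟩, hxy, hne⟩ := hg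
  have hself : pairing s c β x x = pairing s c β y y := congrArg Subtype.val hxy
  have hcross := mem_fixedBy.mp (hE (pairing_mem_fixedBy hc hsc hα hx hy))
  refine ⟨x + y, fun h0 => hne (Subtype.ext (CharTwo.add_eq_zero.mp h0)),
    Submodule.add_mem _ hx hy, ?_⟩
  simp only [pairing_apply, map_add, map_mul, hc _] at hself hcross ⊢
  linear_combination hself + hcross +
    (c β * c (s y) * c y + c β * c (s x) * c y - β * s x * x - β * s x * y)
      * CharTwo.two_eq_zero (R := F)

theorem expSum_quad_eq_zero_or_sq_eq [Fintype F] (hc : Function.Involutive c)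
    (hθ : θ + c θ = 1) (hα : c α = α) :
    expSum (quad s c θ α β) = 0 ∨ expSum (quad s c θ α β) ^ 2 =
      Fintype.card F * Nat.card (ker (polarMap s c α β)) := by
  rw [← ker_polarBilin_quad hc hθ hα]
  exact expSum_eq_zero_or_sq_eq _

theorem exists_natCard_ker_polarMap_eq [Fintype F] (hF : Fintype.card F = Q ^ (2 * a))
    (hc : Function.Involutive c) (hsc : Function.Commute s c) (hθ : θ + c θ = 1)
    (hQ : Nat.card (fixedBy s ⊓ fixedBy c : IntermediateField (ZMod 2) F) = Q)
    (hE : Nat.card (fixedBy (s * c)) = Q ^ e) (hα : c α = α) (h : α ≠ 0 ∨ β ≠ 0) :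
    ∃ t ≤ e, Nat.card (ker (polarMap s c α β)) = Q ^ (2 * t) := by
  have hQ1 : 1 < Q := hQ ▸ Finite.one_lt_card
  have hle : Nat.card (ker (polarMap s c α β)) ≤ Q ^ (2 * e) := by
    rcases eq_or_ne β 0 with rfl | hβ
    · rw [ker_polarMap_zero_right (by simpa using h), Nat.card_unique]
      exact Nat.one_le_pow _ _ (by omega)
    · rw [mul_comm 2, pow_mul, ← hE]
      exact card_ker_polarMap_le hc hsc hα hβ
  obtain ⟨j, hj⟩ := exists_card_mul_card_ker_polarMap_eq (β := β) hc hθ hα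
    (L := fixedBy s ⊓ fixedBy c) (s := s) fun x hx => ⟨mem_fixedBy.mp hx.1, mem_fixedBy.mp hx.2⟩
  rw [Nat.card_eq_fintype_card, hF, hQ] at hj
  have haj : 2 * a ≤ 2 * j := (Nat.pow_dvd_pow_iff_le_right hQ1).mp (Dvd.intro _ hj)
  obtain ⟨t, rfl⟩ := Nat.exists_eq_add_of_le (Nat.le_of_mul_le_mul_left haj two_pos)
  rw [mul_add, pow_add] at hj
  have ht := Nat.eq_of_mul_eq_mul_left (by positivity) hj
  rw [ht, Nat.pow_le_pow_iff_right hQ1] at hle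
  exact ⟨t, by omega, ht⟩

theorem expSum_quad_of_fixedBy_le [Fintype F] (hF : Fintype.card F = Q ^ (2 * a))
    (hca : ∀ x, c x = x ^ Q ^ a) (hsc : Function.Commute s c) (hθ : θ + c θ = 1)
    (hQ : Nat.card (fixedBy s ⊓ fixedBy c : IntermediateField (ZMod 2) F) = Q)
    (hE : Nat.card (fixedBy (s * c)) = Q) (hEc : fixedBy (s * c) ≤ fixedBy c)
    (hα : c α = α) (h : α ≠ 0 ∨ β ≠ 0) :
    (expSum (quad s c θ α β) = Q ^ a ∨ expSum (quad s c θ α β) = -Q ^ a) ∧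
        Nat.card (ker (polarMap s c α β)) = 1 ∨
      (expSum (quad s c θ α β) = 0 ∨ expSum (quad s c θ α β) = -Q ^ (a + 1)) ∧
        Nat.card (ker (polarMap s c α β)) = Q ^ 2 := by
  have hF2 : Fintype.card F = (Q ^ a) ^ 2 := by rw [hF, mul_comm, pow_mul]
  have hc := conj_involutive_of_pow hF2 hca
  have hQ1 : 1 < Q := hQ ▸ Finite.one_lt_card
  obtain ⟨t, ht, hker⟩ := exists_natCard_ker_polarMap_eq (e := 1) hF hc hsc hθ hQ
    (by rw [hE, pow_one]) hα h
  interval_cases t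
  · have hbot : ker (quad s c θ α β).polarBilin = ⊥ := by
      rw [ker_polarBilin_quad hc hθ hα]
      have := (Nat.card_eq_one_iff_unique.mp hker).1
      exact Submodule.eq_bot_of_subsingleton
    have hsq := expSum_sq_of_ker_polarBilin_eq_bot hbot
    rw [hF2, Nat.cast_pow, sq_eq_sq_iff_eq_or_eq_neg] at hsq
    exact Or.inl ⟨by exact_mod_cast hsq, by simpa using hker⟩
  · rw [mul_one] at hker
    have hβ : β ≠ 0 := by
      rintro rfl
      rw [ker_polarMap_zero_right (by simpa using h), Nat.card_unique] at hker
      exact (Nat.one_lt_pow two_ne_zero hQ1).ne hker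
    obtain ⟨x, hx0, hx, hγ⟩ := exists_mem_ker_polarMap_conj_eq hc hsc hα hEc
      (hE.trans_lt (hker ▸ lt_self_pow₀ hQ1 one_lt_two))
    have hval := expSum_quad_eq_zero_or_eq_neg hF2 hca hsc hθ hEc hβ hx0 hx hγ
    rw [hE, Nat.cast_pow, ← pow_succ] at hval
    exact Or.inr ⟨hval, hker⟩

theorem pow_modEq_neg_one_of_odd (Q : ℤ) (ha : Odd a) : Q ^ a ≡ -1 [ZMOD Q + 1] := by
  have h : Q ≡ -1 [ZMOD Q + 1] := (Int.modEq_iff_dvd.mpr ⟨1, by ring⟩ : -1 ≡ Q [ZMOD Q + 1]).symm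
  simpa [ha.neg_one_pow] using h.pow a

theorem expSum_quad_modEq_one [Fintype F] (hF : Fintype.card F = Q ^ (2 * a))
    (hca : ∀ x, c x = x ^ Q ^ a) (hsb : ∀ x, s x = x ^ Q ^ b) (ha : Odd a) (hb : Odd b) :
    expSum (quad s c θ α β) ≡ 1 [ZMOD Q + 1] := by
  have hdvd {i : ℕ} (hi : Odd i) : Q + 1 ∣ Q ^ i + 1 := by
    simpa using hi.nat_add_dvd_pow_add_pow Q 1
  have hnorm {i : ℕ} (hi : Odd i) {t : F} (ht : t ^ (Q + 1) = 1) : t * t ^ Q ^ i = 1 := by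
    obtain ⟨j, hj⟩ := hdvd hi
    rw [← pow_succ', hj, pow_mul, ht, one_pow]
  have hr : Q + 1 ∣ Fintype.card F - 1 := by
    rw [hF, mul_comm, pow_mul]
    exact (hdvd ha).trans ⟨Q ^ a - 1, by simpa using Nat.sq_sub_sq (Q ^ a) 1⟩
  have h := dvd_sum_sub_of_forall_pow_eq_one hr (fun x => sgn (quad s c θ α β x)) fun x t ht => by
    simp only [quad_apply, map_mul, hca t, hsb t]
    congr 2
    linear_combination θ * α * (x * c x) * hnorm ha ht + β * (x * s x) * hnorm hb ht
  rw [QuadraticMap.map_zero, AddChar.map_zero_eq_one] at h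
  exact (Int.modEq_iff_dvd.mpr (by exact_mod_cast h)).symm

theorem expSum_quad_of_odd [Fintype F] (hF : Fintype.card F = Q ^ (2 * a))
    (hca : ∀ x, c x = x ^ Q ^ a) (hsb : ∀ x, s x = x ^ Q ^ b) (ha : Odd a) (hb : Odd b)
    (hsc : Function.Commute s c) (hθ : θ + c θ = 1)
    (hQ : Nat.card (fixedBy s ⊓ fixedBy c : IntermediateField (ZMod 2) F) = Q)
    (hE : Nat.card (fixedBy (s * c)) = Q ^ 2) (hα : c α = α) (h : α ≠ 0 ∨ β ≠ 0) :
    (expSum (quad s c θ α β) = -Q ^ a ∨ expSum (quad s c θ α β) = Q ^ (a + 1) ∨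
        expSum (quad s c θ α β) = -Q ^ (a + 2)) ∧
      expSum (quad s c θ α β) ^ 2 = Fintype.card F * Nat.card (ker (polarMap s c α β)) := by
  have hF2 : Fintype.card F = (Q ^ a) ^ 2 := by rw [hF, mul_comm, pow_mul]
  have hc := conj_involutive_of_pow hF2 hca
  have hQ1 : 1 < Q := hQ ▸ Finite.one_lt_card
  have hmod := expSum_quad_modEq_one (θ := θ) (α := α) (β := β) hF hca hsb ha hb
  have hneg : ¬ (Q : ℤ) + 1 ∣ 2 := fun hdvd => by
    have := Int.le_of_dvd two_pos hdvd
    omega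
  have hne0 : ¬ (0 : ℤ) ≡ 1 [ZMOD Q + 1] := fun h0 =>
    hneg ((Int.modEq_iff_dvd.mp h0).mul_left 2)
  have hne1 : ¬ (-1 : ℤ) ≡ 1 [ZMOD Q + 1] := fun h1 => hneg (Int.modEq_iff_dvd.mp h1)
  have hpow := pow_modEq_neg_one_of_odd (Q : ℤ) ha
  have hQmod := pow_modEq_neg_one_of_odd (Q : ℤ) odd_one
  rw [pow_one] at hQmod
  have hsq := (expSum_quad_eq_zero_or_sq_eq hc hθ hα).resolve_left fun h0 => hne0 (h0 ▸ hmod)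
  refine ⟨?_, hsq⟩
  obtain ⟨t, ht, hker⟩ := exists_natCard_ker_polarMap_eq hF hc hsc hθ hQ hE hα h
  have hroot : expSum (quad s c θ α β) = Q ^ (a + t) ∨ expSum (quad s c θ α β) = -Q ^ (a + t) := by
    rw [← sq_eq_sq_iff_eq_or_eq_neg, hsq, hF, hker]
    push_cast
    ring
  have hpowt : (Q : ℤ) ^ (a + t) ≡ (-1) * (-1) ^ t [ZMOD Q + 1] := by
    rw [pow_add]
    exact hpow.mul (hQmod.pow t)
  interval_cases t
  · exact Or.inl (hroot.resolve_left fun h1 => hne1 (hpowt.symm.trans (h1 ▸ hmod)))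
  · refine Or.inr (Or.inl (hroot.resolve_right fun h1 => hne1 ?_))
    exact hpowt.neg.symm.trans (h1 ▸ hmod)
  · exact Or.inr (Or.inr (hroot.resolve_left fun h1 => hne1 (hpowt.symm.trans (h1 ▸ hmod))))

end Values

theorem exists_add_conj_eq_one {F : Type*} [Field F] [Algebra (ZMod 2) F]
    {c : F ≃ₐ[ZMod 2] F} (hc : Function.Involutive c) (h : c ≠ 1) :
    ∃ θ : F, θ + c θ = 1 := by
  obtain ⟨z, hz⟩ := DFunLike.ne_iff.mp h
  have hw : z + c z ≠ 0 := fun h0 => hz (CharTwo.add_eq_zero.mp h0).symm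
  refine ⟨z / (z + c z), ?_⟩
  rw [map_div₀, map_add, hc, add_comm (c z) z, ← add_div, div_self hw]

section Frobenius

variable {F : Type*} [Field F] [Fintype F] [Algebra (ZMod 2) F] {n m k d : ℕ}

/-- The automorphism `x ↦ x ^ 2 ^ j`. -/
noncomputable def frob (F : Type*) [Field F] [Fintype F] [Algebra (ZMod 2) F] (j : ℕ) :
    F ≃ₐ[ZMod 2] F :=
  FiniteField.frobeniusAlgEquivOfAlgebraic (ZMod 2) F ^ j

theorem frob_apply (j : ℕ) (x : F) : frob F j x = x ^ 2 ^ j := by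
  rw [frob, AlgEquiv.coe_pow, FiniteField.coe_frobeniusAlgEquivOfAlgebraic_iterate, ZMod.card]

theorem frob_mul_frob (i j : ℕ) : frob F i * frob F j = frob F (i + j) := (pow_add _ i j).symm

theorem frob_commute (i j : ℕ) : Function.Commute (frob F i) (frob F j) := fun x =>
  DFunLike.congr_fun (pow_mul_comm (FiniteField.frobeniusAlgEquivOfAlgebraic (ZMod 2) F) i j) x

theorem finrank_zmod_two (hF : Fintype.card F = 2 ^ n) : Module.finrank (ZMod 2) F = n := by
  have h := Module.card_eq_pow_finrank (K := ZMod 2) (V := F)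
  rw [hF, ZMod.card] at h
  exact (Nat.pow_right_injective le_rfl h).symm

theorem natCard_fixedBy_frob (hF : Fintype.card F = 2 ^ n) (j : ℕ) :
    Nat.card (fixedBy (frob F j)) = 2 ^ n.gcd j := by
  rw [frob, natCard_fixedBy_frobenius_pow, finrank_zmod_two hF, Nat.card_zmod]

theorem fixedBy_frob_inf_fixedBy_frob (i j : ℕ) :
    fixedBy (frob F i) ⊓ fixedBy (frob F j) = fixedBy (frob F (i.gcd j)) :=
  fixedBy_pow_inf_fixedBy_pow _ i j

theorem fixedBy_frob_mono {i j : ℕ} (h : i ∣ j) : fixedBy (frob F i) ≤ fixedBy (frob F j) := by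
  rw [← inf_eq_left, fixedBy_frob_inf_fixedBy_frob, Nat.gcd_eq_left h]

theorem fixedBy_frob_gcd (hF : Fintype.card F = 2 ^ n) (j : ℕ) :
    fixedBy (frob F (n.gcd j)) = fixedBy (frob F j) := by
  have htop : fixedBy (frob F n) = ⊤ := eq_top_iff.mpr fun x _ => by
    rw [mem_fixedBy, frob_apply, ← hF, FiniteField.pow_card]
  rw [← fixedBy_frob_inf_fixedBy_frob, htop, top_inf_eq]

theorem gcd_two_mul_add (m k : ℕ) : Nat.gcd (2 * m) (m + k) = Nat.gcd (m + k) (2 * k) := by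
  refine Nat.dvd_antisymm (Nat.dvd_gcd (Nat.gcd_dvd_right _ _) ?_)
    (Nat.dvd_gcd ?_ (Nat.gcd_dvd_left _ _))
  · rw [← Nat.dvd_add_right (Nat.gcd_dvd_left _ _), ← mul_add]
    exact (Nat.gcd_dvd_right _ _).mul_left 2
  · rw [← Nat.dvd_add_left (Nat.gcd_dvd_right _ _), ← mul_add]
    exact (Nat.gcd_dvd_left _ _).mul_left 2

theorem fixedBy_frob_mul_frob (hn : n = 2 * m) (hF : Fintype.card F = 2 ^ n) (k : ℕ) :
    fixedBy (frob F k * frob F m) = fixedBy (frob F (Nat.gcd (m + k) (2 * k))) := by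
  rw [frob_mul_frob, add_comm, ← gcd_two_mul_add, ← hn, fixedBy_frob_gcd hF]

theorem natCard_fixedBy_frob_mul_frob (hn : n = 2 * m) (hF : Fintype.card F = 2 ^ n) (k : ℕ) :
    Nat.card (fixedBy (frob F k * frob F m)) = 2 ^ Nat.gcd (m + k) (2 * k) := by
  rw [frob_mul_frob, natCard_fixedBy_frob hF, hn, add_comm, gcd_two_mul_add]

theorem natCard_fixedBy_frob_inf (hn : n = 2 * m) (hF : Fintype.card F = 2 ^ n) (k : ℕ) :
    Nat.card (fixedBy (frob F k) ⊓ fixedBy (frob F m) : IntermediateField (ZMod 2) F) =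
      2 ^ m.gcd k := by
  rw [fixedBy_frob_inf_fixedBy_frob, natCard_fixedBy_frob hF, Nat.gcd_comm k,
    Nat.gcd_eq_right ((Nat.gcd_dvd_left m k).trans (hn ▸ Dvd.intro_left 2 rfl))]

theorem frob_half_involutive (hn : n = 2 * m) (hF : Fintype.card F = 2 ^ n) :
    Function.Involutive (frob F m) :=
  conj_involutive_of_pow (N := 2 ^ m) (by rw [hF, hn, mul_comm, pow_mul]) (frob_apply m)

end Frobenius

section Subfield

variable {F : Type*} [Field F] [Fintype F] [Algebra (ZMod 2) F]
  {K : IntermediateField (ZMod 2) F} {n m : ℕ}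

theorem exponent_pos {K : Type*} [Finite K] [Nontrivial K] {m : ℕ} (hK : Nat.card K = 2 ^ m) :
    0 < m := by
  refine Nat.pos_of_ne_zero fun h => ?_
  have hcard := Finite.one_lt_card (α := K)
  simp [hK, h] at hcard

theorem eq_fixedBy_frob (hn : n = 2 * m) (hF : Fintype.card F = 2 ^ n)
    (hK : Nat.card K = 2 ^ m) : K = fixedBy (frob F m) := by
  have hle : K ≤ fixedBy (frob F m) := fun x hx => by
    have := Fintype.ofFinite K
    rw [mem_fixedBy, frob_apply, ← hK, Nat.card_eq_fintype_card]
    exact congrArg Subtype.val (FiniteField.pow_card (⟨x, hx⟩ : K))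
  refine SetLike.coe_injective (Set.eq_of_subset_of_ncard_le hle ?_ (Set.toFinite _))
  rw [← Nat.card_coe_set_eq, ← Nat.card_coe_set_eq]
  refine ((natCard_fixedBy_frob hF m).trans ?_).trans_le hK.ge
  rw [hn, Nat.gcd_mul_left_left]

theorem exists_add_frob_eq_one (hn : n = 2 * m) (hF : Fintype.card F = 2 ^ n) (hm : 0 < m) :
    ∃ θ : F, θ + frob F m θ = 1 := by
  refine exists_add_conj_eq_one (frob_half_involutive hn hF) fun h => ?_
  have horder := orderOf_dvd_of_pow_eq_one h
  rw [FiniteField.orderOf_frobeniusAlgEquivOfAlgebraic, finrank_zmod_two hF] at horder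
  have := Nat.le_of_dvd hm horder
  omega

theorem trace_subfield_eq (hn : n = 2 * m) (hF : Fintype.card F = 2 ^ n)
    (hK : Nat.card K = 2 ^ m) {θ : F} (hθ : θ + frob F m θ = 1) (a : K) :
    Algebra.trace (ZMod 2) K a = Algebra.trace (ZMod 2) F (θ * a) := by
  have hfin : Module.finrank K F = 2 := by
    have h := Module.natCard_eq_pow_finrank (K := K) (V := F)
    rw [hK, Nat.card_eq_fintype_card, hF, ← pow_mul, hn, mul_comm] at h
    exact (Nat.eq_of_mul_eq_mul_left (exponent_pos hK) (Nat.pow_right_injective le_rfl h)).symm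
  have hθ1 : Algebra.trace K F θ = 1 := by
    apply (algebraMap K F).injective
    rw [FiniteField.algebraMap_trace_eq_sum_pow, hfin, hK, map_one, Finset.sum_range_succ,
      Finset.sum_range_one, pow_zero, pow_one, pow_one, ← frob_apply, hθ]
  rw [← Algebra.trace_trace (S := K) (θ * (a : F)), show θ * (a : F) = a • θ from mul_comm _ _,
    map_smul, hθ1, smul_eq_mul, mul_one]

theorem traceForm_eq_quad (hn : n = 2 * m) (hF : Fintype.card F = 2 ^ n)
    (hK : Nat.card K = 2 ^ m) (k : ℕ) {θ : F} (hθ : θ + frob F m θ = 1) (α : K) (β x : F) :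
    traceForm hn hF hK k α β x = quad (frob F k) (frob F m) θ α β x := by
  rw [traceForm, trace_subfield_eq hn hF hK hθ, quad_apply, map_add, frob_apply, frob_apply,
    ← pow_succ', ← pow_succ', mul_assoc]
  rfl

theorem T_eq_expSum (hn : n = 2 * m) (hF : Fintype.card F = 2 ^ n)
    (hK : Nat.card K = 2 ^ m) (k : ℕ) {θ : F} (hθ : θ + frob F m θ = 1) (α : K) (β : F) :
    T hn hF hK k α β = expSum (quad (frob F k) (frob F m) θ α β) :=
  Finset.sum_congr rfl fun x _ => by rw [traceForm_eq_quad hn hF hK k hθ, sgn_apply]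

end Subfield

section Values

theorem coe_fst_ne_zero_or_snd_ne_zero {F : Type*} [Field F] [Algebra (ZMod 2) F]
    {K : IntermediateField (ZMod 2) F} {p : K × F} (hp : p ≠ 0) : (p.1 : F) ≠ 0 ∨ p.2 ≠ 0 := by
  rw [← not_and_or]
  exact fun h => hp (Prod.ext (Subtype.ext h.1) h.2)

variable {F : Type*} [Field F] [Fintype F] [Algebra (ZMod 2) F]
  {K : IntermediateField (ZMod 2) F} {n m k d : ℕ}

theorem odd_and_odd_of_gcd_eq_two_mul {a b : ℕ} (hd : 0 < d) (hab : a.Coprime b)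
    (h : 2 * d = Nat.gcd (d * a + d * b) (2 * (d * b))) : Odd a ∧ Odd b := by
  have hdvd : 2 * d ∣ (a + b) * d :=
    (h ▸ Nat.gcd_dvd_left _ _ : 2 * d ∣ d * a + d * b).trans (by rw [← mul_add, mul_comm])
  have hsum : 2 ∣ a + b := Nat.dvd_of_mul_dvd_mul_right hd hdvd
  have hnot : ¬ (2 ∣ a ∧ 2 ∣ b) := fun ⟨ha, hb⟩ =>
    Nat.not_coprime_of_dvd_of_dvd one_lt_two ha hb hab
  rw [Nat.odd_iff, Nat.odd_iff]
  omega

theorem frob_coe_eq_self (hn : n = 2 * m) (hF : Fintype.card F = 2 ^ n)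
    (hK : Nat.card K = 2 ^ m) (α : K) : frob F m α = α :=
  mem_fixedBy.mp (eq_fixedBy_frob hn hF hK ▸ α.2)

theorem T_cases_of_gcd_eq (hn : n = 2 * m) (hF : Fintype.card F = 2 ^ n) (hK : Nat.card K = 2 ^ m)
    (hd : d = Nat.gcd m k) (hd' : d = Nat.gcd (m + k) (2 * k)) {p : K × F} (hp : p ≠ 0) :
    (T hn hF hK k p.1 p.2 = 2 ^ m ∨ T hn hF hK k p.1 p.2 = -2 ^ m) ∧
        Nat.card (ker (polarMap (frob F k) (frob F m) p.1 p.2)) = 1 ∨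
      (T hn hF hK k p.1 p.2 = 0 ∨ T hn hF hK k p.1 p.2 = -2 ^ (m + d)) ∧
        Nat.card (ker (polarMap (frob F k) (frob F m) p.1 p.2)) = 2 ^ (2 * d) := by
  obtain ⟨θ, hθ⟩ := exists_add_frob_eq_one hn hF (exponent_pos hK)
  obtain ⟨a, ha⟩ : d ∣ m := hd ▸ Nat.gcd_dvd_left m k
  have hE := fixedBy_frob_mul_frob hn hF k
  rw [← hd'] at hE
  have hvalues := expSum_quad_of_fixedBy_le (Q := 2 ^ d) (a := a) (β := p.2)
    (by rw [hF, hn, ha, ← pow_mul]; ring_nf) (fun x => by rw [frob_apply, ← pow_mul, ← ha])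
    (frob_commute k m) hθ (by rw [natCard_fixedBy_frob_inf hn hF, hd])
    (by rw [natCard_fixedBy_frob_mul_frob hn hF, ← hd'])
    (hE.trans_le (fixedBy_frob_mono (hd ▸ Nat.gcd_dvd_left m k)))
    (frob_coe_eq_self hn hF hK p.1) (coe_fst_ne_zero_or_snd_ne_zero hp)
  rw [T_eq_expSum hn hF hK k hθ]
  simpa only [Nat.cast_pow, Nat.cast_ofNat, ← pow_mul, mul_add, mul_one, ← ha, mul_comm d 2]
    using hvalues

theorem T_cases_of_gcd_eq_two_mul (hn : n = 2 * m) (hF : Fintype.card F = 2 ^ n)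
    (hK : Nat.card K = 2 ^ m) (hd : d = Nat.gcd m k) (hd' : 2 * d = Nat.gcd (m + k) (2 * k))
    {p : K × F} (hp : p ≠ 0) :
    (T hn hF hK k p.1 p.2 = -2 ^ m ∨ T hn hF hK k p.1 p.2 = 2 ^ (m + d) ∨
        T hn hF hK k p.1 p.2 = -2 ^ (m + 2 * d)) ∧
      T hn hF hK k p.1 p.2 ^ 2 =
        2 ^ n * Nat.card (ker (polarMap (frob F k) (frob F m) p.1 p.2)) := by
  obtain ⟨θ, hθ⟩ := exists_add_frob_eq_one hn hF (exponent_pos hK)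
  obtain ⟨a, b, hab, ha, hb⟩ := Nat.exists_coprime m k
  rw [← hd, mul_comm] at ha hb
  obtain ⟨haodd, hbodd⟩ := odd_and_odd_of_gcd_eq_two_mul
    (hd ▸ Nat.gcd_pos_of_pos_left k (exponent_pos hK)) hab (ha ▸ hb ▸ hd')
  have hvalues := expSum_quad_of_odd (Q := 2 ^ d) (a := a) (b := b) (β := p.2)
    (by rw [hF, hn, ha, ← pow_mul]; ring_nf) (fun x => by rw [frob_apply, ← pow_mul, ← ha])
    (fun x => by rw [frob_apply, ← pow_mul, ← hb]) haodd hbodd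
    (frob_commute k m) hθ (by rw [natCard_fixedBy_frob_inf hn hF, hd])
    (by rw [natCard_fixedBy_frob_mul_frob hn hF, ← hd', mul_comm, pow_mul])
    (frob_coe_eq_self hn hF hK p.1) (coe_fst_ne_zero_or_snd_ne_zero hp)
  rw [T_eq_expSum hn hF hK k hθ]
  simpa only [hF, Nat.cast_pow, Nat.cast_ofNat, ← pow_mul, mul_add, mul_one, ← ha, mul_comm d 2]
    using hvalues

theorem T_zero (hn : n = 2 * m) (hF : Fintype.card F = 2 ^ n) (hK : Nat.card K = 2 ^ m) (k : ℕ) :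
    T hn hF hK k 0 0 = 2 ^ n := by
  simp [T, traceForm, hF]

theorem natCard_ker_polarMap_zero (s c : F ≃ₐ[ZMod 2] F) :
    Nat.card (ker (polarMap s c 0 0)) = Fintype.card F := by
  have htop : ker (polarMap s c 0 0) = ⊤ :=
    LinearMap.ker_eq_top.mpr (LinearMap.ext fun x => by simp [polarMap_apply])
  rw [htop, Nat.card_congr Submodule.topEquiv.toEquiv, Nat.card_eq_fintype_card]

theorem gcd_add_eq_or (hd : d = Nat.gcd m k) :
    Nat.gcd (m + k) (2 * k) = d ∨ Nat.gcd (m + k) (2 * k) = 2 * d := by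
  have h1 : Nat.gcd (m + k) (2 * k) ∣ 2 * d := by
    rw [hd, ← Nat.gcd_mul_left]
    exact Nat.dvd_gcd (gcd_two_mul_add m k ▸ Nat.gcd_dvd_left _ _) (Nat.gcd_dvd_right _ _)
  obtain ⟨e, he⟩ : d ∣ Nat.gcd (m + k) (2 * k) := by
    rw [hd]
    exact Nat.dvd_gcd ((Nat.gcd_dvd_left m k).add (Nat.gcd_dvd_right m k))
      ((Nat.gcd_dvd_right m k).mul_left 2)
  rw [he, mul_comm d e] at h1 ⊢
  rcases Nat.eq_zero_or_pos d with rfl | hpos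
  · simp
  · rcases (Nat.dvd_prime Nat.prime_two).mp (Nat.dvd_of_mul_dvd_mul_right hpos h1) with rfl | rfl
    · simp
    · simp

theorem T_ne_two_pow (hn : n = 2 * m) (hF : Fintype.card F = 2 ^ n) (hK : Nat.card K = 2 ^ m)
    (hd : 2 * Nat.gcd m k ≤ m) {p : K × F} (hp : p ≠ 0) : T hn hF hK k p.1 p.2 ≠ 2 ^ n := by
  have hm := exponent_pos hK
  have hpos : (0 : ℤ) < 2 ^ n := by positivity
  have hlt : ∀ j < n, (2 : ℤ) ^ j ≠ 2 ^ n := fun j hj => (pow_lt_pow_right₀ one_lt_two hj).ne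
  have hneg : ∀ j, -(2 : ℤ) ^ j ≠ 2 ^ n := fun j h => by
    have : (0 : ℤ) < 2 ^ j := by positivity
    omega
  rcases gcd_add_eq_or (m := m) (k := k) rfl with hd' | hd'
  · rcases T_cases_of_gcd_eq hn hF hK rfl hd'.symm hp with ⟨h | h, -⟩ | ⟨h | h, -⟩ <;> rw [h]
    exacts [hlt _ (by omega), hneg _, hpos.ne, hneg _]
  · rcases (T_cases_of_gcd_eq_two_mul hn hF hK rfl hd'.symm hp).1 with h | h | h <;> rw [h]
    exacts [hneg _, hlt _ (by omega), hneg _]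

theorem ncard_T_eq_two_pow (hn : n = 2 * m) (hF : Fintype.card F = 2 ^ n)
    (hK : Nat.card K = 2 ^ m) (hd : 2 * Nat.gcd m k ≤ m) :
    {p : K × F | T hn hF hK k p.1 p.2 = 2 ^ n}.ncard = 1 := by
  refine Set.ncard_eq_one.mpr ⟨0, Set.ext fun p => ⟨fun hp => ?_, ?_⟩⟩
  · exact by_contra fun hne => T_ne_two_pow hn hF hK hd hne hp
  · rintro rfl
    exact T_zero hn hF hK k

theorem sum_T [Fintype K] (hn : n = 2 * m) (hF : Fintype.card F = 2 ^ n)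
    (hK : Nat.card K = 2 ^ m) (k : ℕ) :
    ∑ p : K × F, T hn hF hK k p.1 p.2 = 2 ^ n * 2 ^ m := by
  obtain ⟨θ, hθ⟩ := exists_add_frob_eq_one hn hF (exponent_pos hK)
  have hKc : Fintype.card K = 2 ^ m := by rw [← hK, Nat.card_eq_fintype_card]
  obtain rfl := eq_fixedBy_frob hn hF hK
  simp only [T_eq_expSum hn hF hK k hθ]
  rw [sum_expSum_quad (frob_half_involutive hn hF) hθ, Fintype.card_prod, hKc, hF]
  push_cast
  ring

theorem sum_T_sq_of_gcd_eq [Fintype K] (hn : n = 2 * m) (hF : Fintype.card F = 2 ^ n)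
    (hK : Nat.card K = 2 ^ m) (hd : d = Nat.gcd m k) (hd' : d = Nat.gcd (m + k) (2 * k)) :
    ∑ p : K × F, T hn hF hK k p.1 p.2 ^ 2 = 2 ^ n * 2 ^ n * 2 ^ m := by
  obtain ⟨θ, hθ⟩ := exists_add_frob_eq_one hn hF (exponent_pos hK)
  have hKc : Fintype.card K = 2 ^ m := by rw [← hK, Nat.card_eq_fintype_card]
  have hE : fixedBy (frob F k * frob F m) ≤ fixedBy (frob F m) := by
    rw [fixedBy_frob_mul_frob hn hF, ← hd', hd]
    exact fixedBy_frob_mono (Nat.gcd_dvd_left m k)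
  obtain rfl := eq_fixedBy_frob hn hF hK
  simp only [T_eq_expSum hn hF hK k hθ]
  rw [sum_expSum_quad_sq (frob_half_involutive hn hF) (frob_commute k m) hθ hE, Fintype.card_prod,
    hKc, hF]
  push_cast
  ring

theorem sum_natCard_ker_polarMap_frob [Fintype K] (hn : n = 2 * m) (hF : Fintype.card F = 2 ^ n)
    (hK : Nat.card K = 2 ^ m) (k : ℕ) :
    ∑ p : K × F, (Nat.card (ker (polarMap (frob F k) (frob F m) p.1 p.2)) : ℤ) =
      2 ^ n * 2 ^ m + (2 ^ n - 1) * (2 ^ m * 2 ^ m.gcd k) := by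
  obtain ⟨θ, hθ⟩ := exists_add_frob_eq_one hn hF (exponent_pos hK)
  have hKc : Fintype.card K = 2 ^ m := by rw [← hK, Nat.card_eq_fintype_card]
  obtain rfl := eq_fixedBy_frob hn hF hK
  rw [← Nat.cast_sum, sum_card_ker_polarMap (frob_half_involutive hn hF) (frob_commute k m) hθ,
    natCard_fixedBy_frob_inf hn hF, Fintype.card_prod, hKc, hK, hF]
  push_cast [Nat.one_le_two_pow]
  ring

theorem sum_T_sq_of_gcd_eq_two_mul [Fintype K] (hn : n = 2 * m) (hF : Fintype.card F = 2 ^ n)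
    (hK : Nat.card K = 2 ^ m) (hd : d = Nat.gcd m k) (hd' : 2 * d = Nat.gcd (m + k) (2 * k)) :
    ∑ p : K × F, T hn hF hK k p.1 p.2 ^ 2 =
      2 ^ n * (2 ^ n * 2 ^ m + (2 ^ n - 1) * (2 ^ m * 2 ^ d)) := by
  rw [hd, ← sum_natCard_ker_polarMap_frob hn hF hK, Finset.mul_sum]
  refine Finset.sum_congr rfl fun p _ => ?_
  by_cases hp : p = 0
  · subst hp
    rw [Prod.fst_zero, Prod.snd_zero, T_zero, ZeroMemClass.coe_zero, natCard_ker_polarMap_zero, hF]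
    push_cast
    ring
  · exact (T_cases_of_gcd_eq_two_mul hn hF hK hd hd' hp).2

theorem two_pow_mul_natCard_ker_polarMap (hn : n = 2 * m) (hF : Fintype.card F = 2 ^ n)
    (hK : Nat.card K = 2 ^ m) (hd : d = Nat.gcd m k) (hd' : d = Nat.gcd (m + k) (2 * k))
    (p : K × F) :
    (2 ^ n * Nat.card (ker (polarMap (frob F k) (frob F m) p.1 p.2)) : ℤ) =
      T hn hF hK k p.1 p.2 ^ 2 +
        2 ^ n * 2 ^ (2 * d) * if T hn hF hK k p.1 p.2 = 0 then 1 else 0 := by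
  by_cases hp : p = 0
  · subst hp
    rw [Prod.fst_zero, Prod.snd_zero, T_zero, ZeroMemClass.coe_zero, natCard_ker_polarMap_zero, hF,
      if_neg (by positivity)]
    push_cast
    ring
  · rcases T_cases_of_gcd_eq hn hF hK hd hd' hp with ⟨h | h, hker⟩ | ⟨h | h, hker⟩ <;>
      rw [h, hker, hn]
    · rw [if_neg (by positivity)]; push_cast; ring
    · rw [if_neg (by simp)]; push_cast; ring
    · rw [if_pos rfl]; push_cast; ring
    · rw [if_neg (by simp)]; push_cast; ring

theorem ncard_T_eq_zero (hn : n = 2 * m) (hF : Fintype.card F = 2 ^ n) (hK : Nat.card K = 2 ^ m)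
    (hd : d = Nat.gcd m k) (hd' : d = Nat.gcd (m + k) (2 * k)) :
    ({p : K × F | T hn hF hK k p.1 p.2 = 0}.ncard : ℤ) = 2 ^ (m - d) * (2 ^ n - 1) := by
  classical
  have := Fintype.ofFinite K
  have hcount : ∑ p : K × F, (if T hn hF hK k p.1 p.2 = 0 then 1 else 0 : ℤ) =
      ({p : K × F | T hn hF hK k p.1 p.2 = 0}.ncard : ℤ) := by
    rw [Finset.sum_boole, Set.ncard_eq_toFinset_card', Set.toFinset_ofPred]
  have hsum := Finset.sum_congr rfl fun p (_ : p ∈ Finset.univ) =>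
    two_pow_mul_natCard_ker_polarMap hn hF hK hd hd' p
  rw [Finset.sum_add_distrib, ← Finset.mul_sum, ← Finset.mul_sum, hcount,
    sum_natCard_ker_polarMap_frob hn hF hK, sum_T_sq_of_gcd_eq hn hF hK hd hd', ← hd] at hsum
  have hm : (2 : ℤ) ^ m = 2 ^ d * 2 ^ (m - d) := by
    rw [← pow_add,
      Nat.add_sub_cancel' (Nat.le_of_dvd (exponent_pos hK) (hd ▸ Nat.gcd_dvd_left m k))]
  apply mul_left_cancel₀ (by positivity : (2 ^ n * 2 ^ (2 * d) : ℤ) ≠ 0)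
  linear_combination -hsum + 2 ^ n * 2 ^ d * (2 ^ n - 1) * hm

end Values

section CyclicCode

variable {l : ℕ}

theorem wordPoly_eq_degreeLTEquiv_symm (w : Fin l → ZMod 2) :
    wordPoly w = (degreeLTEquiv (ZMod 2) l).symm w :=
  Finset.sum_congr rfl fun _ _ => C_mul_X_pow_eq_monomial

theorem degree_wordPoly_lt (w : Fin l → ZMod 2) : (wordPoly w).degree < l :=
  mem_degreeLT.mp (wordPoly_eq_degreeLTEquiv_symm w ▸ Subtype.property _)

theorem wordPoly_injective : Function.Injective (wordPoly (l := l)) := fun v w h => by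
  rw [wordPoly_eq_degreeLTEquiv_symm, wordPoly_eq_degreeLTEquiv_symm] at h
  exact (degreeLTEquiv (ZMod 2) l).symm.injective (Subtype.ext h)

theorem exists_mem_degreeLT_wordPoly_mul_eq (hl : 0 < l) {h : (ZMod 2)[X]} (h0 : h ≠ 0)
    {w : Fin l → ZMod 2} (hw : w ∈ cyclicCode l h) :
    ∃ q ∈ degreeLT (ZMod 2) h.natDegree, wordPoly w * h = (X ^ l - 1) * q := by
  obtain ⟨q, hq⟩ : (X ^ l - 1 : (ZMod 2)[X]) ∣ wordPoly w * h := hw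
  refine ⟨q, mem_degreeLT.mpr ?_, hq⟩
  rw [← degree_eq_natDegree h0]
  have hdegree : l + q.degree = (wordPoly w).degree + h.degree := by
    rw [← degree_mul, hq, degree_mul, ← degree_X_pow_sub_C (R := ZMod 2) hl 1, map_one]
  refine lt_of_not_ge fun hle => ?_
  have hlt := WithBot.add_lt_add_right (degree_ne_bot.mpr h0) (degree_wordPoly_lt w)
  exact hlt.not_ge (hdegree ▸ add_le_add_right hle _)

theorem natCard_cyclicCode_le (hl : 0 < l) {h : (ZMod 2)[X]} (h0 : h ≠ 0) :
    Nat.card (cyclicCode l h) ≤ 2 ^ h.natDegree := by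
  choose q hq hwq using fun w : cyclicCode l h =>
    exists_mem_degreeLT_wordPoly_mul_eq hl h0 w.2
  have hinj : Function.Injective fun w => degreeLTEquiv (ZMod 2) h.natDegree ⟨q w, hq w⟩ := by
    intro v w hvw
    have hqq : q v = q w := congrArg Subtype.val ((degreeLTEquiv (ZMod 2) _).injective hvw)
    exact Subtype.ext (wordPoly_injective (mul_right_cancel₀ h0 (by rw [hwq, hwq, hqq])))
  simpa using Nat.card_le_card_of_injective _ hinj

theorem cyclicCode_mono {h g : (ZMod 2)[X]} (hdvd : h ∣ g) : cyclicCode l h ≤ cyclicCode l g :=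
  fun w hw => (show (X ^ l - 1 : (ZMod 2)[X]) ∣ wordPoly w * h from hw).trans
    (mul_dvd_mul_left _ hdvd)

theorem X_pow_sub_one_dvd_of_isRoot {F : Type*} [Field F] (hl : 0 < l) {ζ : F}
    (hζ : IsPrimitiveRoot ζ l) {P : F[X]} (hP : ∀ y, y ^ l = 1 → P.IsRoot y) :
    X ^ l - 1 ∣ P := by
  classical
  rw [X_pow_sub_one_eq_prod hl hζ]
  exact Finset.prod_dvd_of_coprime
    (fun a _ b _ hab => pairwise_coprime_X_sub_C Function.injective_id hab)
    fun y hy => dvd_iff_isRoot.mpr (hP y ((mem_nthRootsFinset hl 1).mp hy))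

theorem aeval_minpoly_inv_eq_zero {k F : Type*} [Field k] [Fintype k] [Field F] [Algebra k F]
    {η y : F} {t : ℕ} (h : η ^ Fintype.card k ^ t * y = 1) : aeval y (minpoly k η⁻¹) = 0 := by
  have hy : y = (FiniteField.frobeniusAlgHom k F ^ t) η⁻¹ := by
    rw [AlgHom.coe_pow, FiniteField.coe_frobeniusAlgHom, pow_iterate]
    exact (eq_inv_of_mul_eq_one_right h).trans (inv_pow η _).symm
  rw [hy, aeval_algHom_apply, minpoly.aeval, map_zero]

theorem sum_trace_mul_pow_eq_zero {k F : Type*} [Field k] [Field F] [Finite F] [Algebra k F]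
    {b η y : F} (hη : η ^ l = 1) (hy : y ^ l = 1)
    (h : aeval y (minpoly k η⁻¹) ≠ 0) :
    ∑ i ∈ Finset.range l, algebraMap k F (Algebra.trace k F (b * η ^ i)) * y ^ i = 0 := by
  have := Finite.of_injective _ (algebraMap k F).injective
  have := Fintype.ofFinite k
  simp only [FiniteField.algebraMap_trace_eq_sum_pow, Finset.sum_mul]
  rw [Finset.sum_comm]
  refine Finset.sum_eq_zero fun t _ => ?_
  rw [Nat.card_eq_fintype_card]
  set z := η ^ Fintype.card k ^ t * y
  have hz : z ^ l = 1 := by rw [mul_pow, hy, mul_one, pow_right_comm, hη, one_pow]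
  calc ∑ i ∈ Finset.range l, (b * η ^ i) ^ Fintype.card k ^ t * y ^ i
      = b ^ Fintype.card k ^ t * ∑ i ∈ Finset.range l, z ^ i := by
        rw [Finset.mul_sum]
        exact Finset.sum_congr rfl fun i _ => by
          rw [mul_pow, mul_pow, pow_right_comm, mul_assoc]
    _ = 0 := by
        rw [geom_sum_eq fun h1 => h (aeval_minpoly_inv_eq_zero h1), hz, sub_self, zero_div,
          mul_zero]

theorem trace_mul_pow_mem_cyclicCode {F : Type*} [Field F] [Finite F] [Algebra (ZMod 2) F]
    (hl : 0 < l) {ζ : F} (hζ : IsPrimitiveRoot ζ l) (b : F) {η : F} (hη : η ^ l = 1) :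
    (fun i : Fin l => Algebra.trace (ZMod 2) F (b * η ^ (i : ℕ))) ∈
      cyclicCode l (minpoly (ZMod 2) η⁻¹) := by
  change (X ^ l - 1 : (ZMod 2)[X]) ∣ _
  rw [← map_dvd_map' (algebraMap (ZMod 2) F), Polynomial.map_sub, Polynomial.map_pow, map_X,
    Polynomial.map_one]
  refine X_pow_sub_one_dvd_of_isRoot hl hζ fun y hy => ?_
  rw [IsRoot, eval_map_algebraMap, map_mul, mul_eq_zero, or_iff_not_imp_right]
  intro hne
  rw [← sum_trace_mul_pow_eq_zero (b := b) hη hy hne, Finset.sum_range, wordPoly, map_sum]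
  exact Finset.sum_congr rfl fun i _ => by rw [map_mul, aeval_C, map_pow, aeval_X]

end CyclicCode

section Weight

theorem bijective_pow_fin {G : Type*} [Group G] [Fintype G] {g : G}
    (hg : ∀ y, y ∈ Subgroup.zpowers g) {l : ℕ} (hl : Fintype.card G = l) :
    Function.Bijective fun i : Fin l => g ^ (i : ℕ) := by
  rw [Fintype.bijective_iff_injective_and_card]
  refine ⟨fun i j hij => Fin.ext ?_, by rw [Fintype.card_fin, hl]⟩
  have horder : orderOf g = l := by
    rw [orderOf_eq_card_of_forall_mem_zpowers hg, Nat.card_eq_fintype_card, hl]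
  exact pow_injOn_Iio_orderOf (horder ▸ i.2) (horder ▸ j.2) hij

theorem sum_sgn_eq_card_sub_hammingNorm {ι : Type*} [Fintype ι] (w : ι → ZMod 2) :
    ∑ i, sgn (w i) = Fintype.card ι - 2 * hammingNorm w := by
  have hsgn : ∀ a : ZMod 2, sgn a = 1 - 2 * if a ≠ 0 then 1 else 0 := by decide
  simp only [hsgn, Finset.sum_sub_distrib, ← Finset.mul_sum, Finset.sum_boole, Finset.sum_const,
    Finset.card_univ, nsmul_eq_mul, mul_one, hammingNorm]

theorem sum_eq_add_sum_pow {F M : Type*} [Field F] [Fintype F] [AddCommMonoid M] {π : Fˣ}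
    (hπ : ∀ y : Fˣ, y ∈ Subgroup.zpowers π) {l : ℕ} (hl : Fintype.card F = l + 1) (f : F → M) :
    ∑ x, f x = f 0 + ∑ i : Fin l, f ((π : F) ^ (i : ℕ)) := by
  classical
  have hunits : Fintype.card Fˣ = l := by rw [Fintype.card_units, hl, Nat.add_sub_cancel]
  rw [sum_eq_add_sum_units, ← (bijective_pow_fin hπ hunits).sum_comp]
  simp only [Units.val_pow_eq_pow_val]

end Weight

section Code

variable {F : Type*} [Field F] [Fintype F] [Algebra (ZMod 2) F]
  {K : IntermediateField (ZMod 2) F} {n m k : ℕ}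

theorem T_eq_sub_hammingNorm (hn : n = 2 * m) (hF : Fintype.card F = 2 ^ n)
    (hK : Nat.card K = 2 ^ m) (k : ℕ) {π : Fˣ} (hπ : ∀ y : Fˣ, y ∈ Subgroup.zpowers π)
    (α : K) (β : F) :
    T hn hF hK k α β = 2 ^ n - 2 * hammingNorm (word hn hF hK k π α β) := by
  have hl : Fintype.card F = 2 ^ n - 1 + 1 := by rw [hF, Nat.sub_add_cancel Nat.one_le_two_pow]
  have hzero : sgn (traceForm hn hF hK k α β 0) = 1 := by
    obtain ⟨θ, hθ⟩ := exists_add_frob_eq_one hn hF (exponent_pos hK)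
    rw [traceForm_eq_quad hn hF hK k hθ, QuadraticMap.map_zero, AddChar.map_zero_eq_one]
  have hsum := sum_sgn_eq_card_sub_hammingNorm (word hn hF hK k π α β)
  rw [Fintype.card_fin, Nat.cast_sub Nat.one_le_two_pow] at hsum
  simp only [T, ← sgn_apply]
  rw [sum_eq_add_sum_pow hπ hl fun x => sgn (traceForm hn hF hK k α β x), hzero]
  change 1 + ∑ i, sgn (word hn hF hK k π α β i) = _
  rw [hsum]
  push_cast
  ring

theorem word_sub (hn : n = 2 * m) (hF : Fintype.card F = 2 ^ n) (hK : Nat.card K = 2 ^ m) (k : ℕ)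
    (π : Fˣ) (p q : K × F) :
    word hn hF hK k π (p - q).1 (p - q).2 =
      word hn hF hK k π p.1 p.2 - word hn hF hK k π q.1 q.2 := by
  ext i
  simp only [word, traceForm, Prod.fst_sub, Prod.snd_sub, sub_mul, map_sub, Pi.sub_apply]
  ring

theorem word_eq_add (hn : n = 2 * m) (hF : Fintype.card F = 2 ^ n) (hK : Nat.card K = 2 ^ m)
    (k : ℕ) (π : Fˣ) {θ : F} (hθ : θ + frob F m θ = 1) (α : K) (β : F) :
    word hn hF hK k π α β =
      (fun i : Fin (2 ^ n - 1) =>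
        Algebra.trace (ZMod 2) F (θ * α * ((π : F) ^ (2 ^ m + 1)) ^ (i : ℕ))) +
        fun i : Fin (2 ^ n - 1) =>
          Algebra.trace (ZMod 2) F (β * ((π : F) ^ (2 ^ k + 1)) ^ (i : ℕ)) := by
  ext i
  rw [word, traceForm, trace_subfield_eq hn hF hK hθ, pow_right_comm (π : F), Pi.add_apply,
    pow_right_comm (π : F) (2 ^ m + 1), mul_assoc]
  rfl

theorem word_mem_codeC1 (hn : n = 2 * m) (hF : Fintype.card F = 2 ^ n) (hK : Nat.card K = 2 ^ m)
    (k : ℕ) {π : Fˣ} (hπ : ∀ y : Fˣ, y ∈ Subgroup.zpowers π) (α : K) (β : F) :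
    word hn hF hK k π α β ∈ codeC1 n m k π := by
  classical
  obtain ⟨θ, hθ⟩ := exists_add_frob_eq_one hn hF (exponent_pos hK)
  have hcard : Nat.card Fˣ = 2 ^ n - 1 := by
    rw [Nat.card_eq_fintype_card, Fintype.card_units, hF]
  have hprim : IsPrimitiveRoot (π : F) (2 ^ n - 1) := by
    rw [IsPrimitiveRoot.coe_units_iff, ← hcard, ← orderOf_eq_card_of_forall_mem_zpowers hπ]
    exact IsPrimitiveRoot.orderOf π
  have hmem (j : ℕ) (b : F) : (fun i : Fin (2 ^ n - 1) =>
      Algebra.trace (ZMod 2) F (b * ((π : F) ^ j) ^ (i : ℕ))) ∈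
        cyclicCode (2 ^ n - 1) (minpoly (ZMod 2) ((π : F)⁻¹ ^ j)) := by
    rw [inv_pow]
    exact trace_mul_pow_mem_cyclicCode (hcard ▸ Nat.card_pos) hprim b
      (by rw [pow_right_comm, hprim.pow_eq_one, one_pow])
  rw [word_eq_add hn hF hK k π hθ]
  exact add_mem (cyclicCode_mono (dvd_mul_left _ _) (hmem _ _))
    (cyclicCode_mono (dvd_mul_right _ _) (hmem _ _))

theorem natDegree_parityPoly_le (hn : n = 2 * m) (hF : Fintype.card F = 2 ^ n)
    (hK : Nat.card K = 2 ^ m) (k : ℕ) (π : Fˣ) : (parityPoly m k π).natDegree ≤ n + m := by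
  have := Fintype.ofFinite K
  refine natDegree_mul_le.trans (Nat.add_le_add ?_ ?_)
  · exact (minpoly.natDegree_le _).trans_eq (finrank_zmod_two hF)
  · have h := minpoly.natDegree_le (A := ZMod 2)
      (⟨(π : F)⁻¹ ^ (2 ^ m + 1), pow_mem_subfield hn hF hK _⟩ : K)
    rwa [finrank_zmod_two (by rw [← hK, Nat.card_eq_fintype_card]),
      ← minpoly.algebraMap_eq (algebraMap K F).injective] at h

theorem ncard_codeC1_le (hn : n = 2 * m) (hF : Fintype.card F = 2 ^ n)
    (hK : Nat.card K = 2 ^ m) (k : ℕ) (π : Fˣ) :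
    (codeC1 n m k π : Set (Fin (2 ^ n - 1) → ZMod 2)).ncard ≤ 2 ^ (n + m) := by
  have hne (x : F) : minpoly (ZMod 2) x ≠ 0 := minpoly.ne_zero (Algebra.IsIntegral.isIntegral x)
  have hl : 0 < 2 ^ n - 1 := by
    have := Nat.one_lt_two_pow (n := n) (by have := exponent_pos hK; omega)
    omega
  rw [← Nat.card_coe_set_eq]
  exact (natCard_cyclicCode_le hl (mul_ne_zero (hne _) (hne _))).trans
    (Nat.pow_le_pow_right two_pos (natDegree_parityPoly_le hn hF hK k π))

theorem bijOn_word (hn : n = 2 * m) (hF : Fintype.card F = 2 ^ n) (hK : Nat.card K = 2 ^ m)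
    (hd : 2 * Nat.gcd m k ≤ m) {π : Fˣ} (hπ : ∀ y : Fˣ, y ∈ Subgroup.zpowers π) :
    Set.BijOn (fun p : K × F => word hn hF hK k π p.1 p.2) Set.univ
      (codeC1 n m k π : Set (Fin (2 ^ n - 1) → ZMod 2)) := by
  have hmaps : Set.MapsTo (fun p : K × F => word hn hF hK k π p.1 p.2) Set.univ
      (codeC1 n m k π : Set (Fin (2 ^ n - 1) → ZMod 2)) :=
    fun p _ => word_mem_codeC1 hn hF hK k hπ p.1 p.2
  have hinj : Set.InjOn (fun p : K × F => word hn hF hK k π p.1 p.2) Set.univ := by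
    intro p _ q _ hpq
    have hT := T_eq_sub_hammingNorm hn hF hK k hπ (p - q).1 (p - q).2
    rw [word_sub, sub_eq_zero.mpr hpq, hammingNorm_zero, Nat.cast_zero, mul_zero, sub_zero] at hT
    exact sub_eq_zero.mp (by_contra fun hne => T_ne_two_pow hn hF hK hd hne hT)
  refine ⟨hmaps, hinj, (Set.eq_of_subset_of_ncard_le hmaps.image_subset ?_ (Set.toFinite _)).ge⟩
  rw [hinj.ncard_image, Set.ncard_univ, Nat.card_prod, hK, Nat.card_eq_fintype_card, hF, mul_comm,
    ← pow_add]
  exact ncard_codeC1_le hn hF hK k π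

end Code

section Moments

theorem sum_pow_eq_sum_map_ncard {ι : Type*} [Fintype ι] {f : ι → ℤ} {V : List ℤ} (hV : V.Nodup)
    (hf : ∀ i, f i ∈ V) (j : ℕ) :
    ∑ i, f i ^ j = (V.map fun v => v ^ j * ({i | f i = v}.ncard : ℤ)).sum := by
  classical
  rw [← List.sum_toFinset _ hV, ← Finset.sum_fiberwise_of_maps_to (t := V.toFinset) (g := f)
    fun i _ => List.mem_toFinset.mpr (hf i)]
  refine Finset.sum_congr rfl fun v _ => ?_
  rw [Finset.sum_congr rfl fun i hi => by rw [(Finset.mem_filter.mp hi).2], Finset.sum_const,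
    nsmul_eq_mul, mul_comm, Set.ncard_eq_toFinset_card', Set.toFinset_ofPred]

/-- To be read with `A = 2 ^ m`, `D = 2 ^ d`, `R = 2 ^ (m - d)`, `P = 2 ^ (d - 1)`, where `a`, `b`,
`e`, `z` are the multiplicities of `2 ^ m`, `-2 ^ m`, `-2 ^ (m + d)`, `0`. -/
theorem multiplicities_of_moments {A D R P a b e z : ℚ} (hA : A = D * R) (hP : D = 2 * P)
    (hA0 : A ≠ 0) (hD : 2 ≤ D) (hz : z = R * (A ^ 2 - 1)) (h0 : a + b + e + z + 1 = A ^ 3)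
    (h1 : A * a - A * b - A * D * e + A ^ 2 = A ^ 3)
    (h2 : A ^ 2 * a + A ^ 2 * b + (A * D) ^ 2 * e + A ^ 4 = A ^ 5) :
    a = P * (A - 1) * (A ^ 2 + 2 * A + 1) / (D + 1) ∧
    b = P * (A - 1) * (A ^ 2 - 2 * A * R + 1) / (D - 1) ∧
    e = (R - 1) * (A ^ 2 - 1) / (D ^ 2 - 1) := by
  have h1' : a - b - D * e + A = A ^ 2 := mul_left_cancel₀ hA0 (by linear_combination h1)
  have h2' : a + b + D ^ 2 * e + A ^ 2 = A ^ 3 :=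
    mul_left_cancel₀ (pow_ne_zero 2 hA0) (by linear_combination h2)
  have he : e * (D ^ 2 - 1) = (R - 1) * (A ^ 2 - 1) := by linear_combination h2' - h0 + hz
  refine ⟨?_, ?_, ?_⟩
  · rw [eq_div_iff (by positivity)]
    linear_combination (D + 1) / 2 * (h0 + h1') + he / 2 - (D + 1) / 2 * hz
      + (A - 1) * (A ^ 2 + 2 * A + 1) / 2 * hP + (A ^ 2 - 1) / 2 * hA
  · rw [eq_div_iff (by linarith)]
    linear_combination (D - 1) / 2 * (h0 - h1') - he / 2 - (D - 1) / 2 * hz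
      + (A - 1) * (A ^ 2 - 2 * A * R + 1) / 2 * hP - (A - 1) * (A - 1) / 2 * hA
  · rwa [eq_div_iff (by nlinarith)]

/-- To be read with `A = 2 ^ m`, `D = 2 ^ d`, `R = 2 ^ (m - d)`, `S = 2 ^ (m - 2 * d)`, where `x`,
`y`, `w` are the multiplicities of `-2 ^ m`, `2 ^ (m + d)`, `-2 ^ (m + 2 * d)`. -/
theorem multiplicities_of_moments_two_mul {A D R S x y w : ℚ} (hA : A = D * R) (hR : R = D * S)
    (hA0 : A ≠ 0) (hD : 2 ≤ D) (h0 : x + y + w + 1 = A ^ 3)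
    (h1 : -A * x + A * D * y - A * D ^ 2 * w + A ^ 2 = A ^ 3)
    (h2 : A ^ 2 * x + (A * D) ^ 2 * y + (A * D ^ 2) ^ 2 * w + A ^ 4 =
      A ^ 2 * (A ^ 3 + (A ^ 2 - 1) * (A * D))) :
    x = D ^ 3 * (A - 1) * (A ^ 2 - R ^ 2 - R * S + A - R + 1) / ((D + 1) * (D ^ 2 - 1)) ∧
    y = D * (A ^ 2 - 1) * (A + R + S + 1) / (D + 1) ^ 2 ∧
    w = (R - 1) * (A ^ 2 - 1) / ((D + 1) * (D ^ 2 - 1)) := by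
  have h1' : -x + D * y - D ^ 2 * w + A = A ^ 2 := mul_left_cancel₀ hA0 (by linear_combination h1)
  have h2' : x + D ^ 2 * y + D ^ 4 * w + A ^ 2 = A ^ 3 + (A ^ 2 - 1) * (A * D) :=
    mul_left_cancel₀ (pow_ne_zero 2 hA0) (by linear_combination h2)
  have hD' : 0 < (D + 1) * (D ^ 2 - 1) := mul_pos (by linarith) (by nlinarith)
  have hw : w * ((D + 1) * (D ^ 2 - 1)) = (R - 1) * (A ^ 2 - 1) :=
    mul_left_cancel₀ (show D ≠ 0 by positivity)
      (by linear_combination h2' - h0 - (D - 1) * (h0 + h1') + (A ^ 2 - 1) * hA)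
  have hy : y * (D + 1) ^ 2 = D * (A ^ 2 - 1) * (A + R + S + 1) := by
    subst hR hA
    exact mul_left_cancel₀ (show D - 1 ≠ 0 by linarith)
      (by linear_combination (D - 1) * (D + 1) * (h0 + h1') + (D - 1) * hw)
  refine ⟨?_, (eq_div_iff (by positivity)).mpr hy, (eq_div_iff hD'.ne').mpr hw⟩
  rw [eq_div_iff hD'.ne']
  subst hR hA
  linear_combination (D + 1) * (D ^ 2 - 1) * h0 - (D - 1) * hy - hw

end Moments

section Parameters

variable {n m k d : ℕ}

theorem two_mul_gcd_le (hm : 0 < m) (hn : n = 2 * m) (hk1 : 1 ≤ k) (hk2 : k ≤ n - 1)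
    (hkm : k ≠ m) : 2 * Nat.gcd m k ≤ m := by
  obtain ⟨a, ha⟩ := Nat.gcd_dvd_left m k
  have ha0 : a ≠ 0 := by rintro rfl; omega
  have ha1 : a ≠ 1 := by
    rintro rfl
    obtain ⟨b, rfl⟩ : m ∣ k := Nat.gcd_eq_left_iff_dvd.mp (by omega)
    have hb : b < 2 := lt_of_mul_lt_mul_left (show m * b < m * 2 by omega) m.zero_le
    interval_cases b <;> omega
  calc 2 * Nat.gcd m k ≤ a * Nat.gcd m k := Nat.mul_le_mul_right _ (by omega)
    _ = m := by rw [mul_comm, ← ha]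

/-- The distribution table in the case `d' = d`. -/
def tableOfEq (n m d : ℕ) : List (ℤ × ℕ × ℚ) :=
  [(2 ^ m, 2 ^ (n - 1) - 2 ^ (m - 1),
      2 ^ (d - 1) * (2 ^ m - 1) * (2 ^ n + 2 ^ (m + 1) + 1) / (2 ^ d + 1)),
    (-2 ^ m, 2 ^ (n - 1) + 2 ^ (m - 1),
      2 ^ (d - 1) * (2 ^ m - 1) * (2 ^ n - 2 ^ (n - d + 1) + 1) / (2 ^ d - 1)),
    (-2 ^ (m + d), 2 ^ (n - 1) + 2 ^ (m + d - 1),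
      (2 ^ (m - d) - 1) * (2 ^ n - 1) / (2 ^ (2 * d) - 1)),
    (0, 2 ^ (n - 1), 2 ^ (m - d) * (2 ^ n - 1)),
    (2 ^ n, 0, 1)]

/-- The distribution table in the case `d' = 2 * d`. -/
def tableOfEqTwoMul (n m d : ℕ) : List (ℤ × ℕ × ℚ) :=
  [(-2 ^ m, 2 ^ (n - 1) + 2 ^ (m - 1),
      2 ^ (3 * d) * (2 ^ m - 1) *
        (2 ^ n - 2 ^ (n - 2 * d) - 2 ^ (n - 3 * d) + 2 ^ m - 2 ^ (m - d) + 1) /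
          ((2 ^ d + 1) * (2 ^ (2 * d) - 1))),
    (2 ^ (m + d), 2 ^ (n - 1) - 2 ^ (m + d - 1),
      2 ^ d * (2 ^ n - 1) * (2 ^ m + 2 ^ (m - d) + 2 ^ (m - 2 * d) + 1) / (2 ^ d + 1) ^ 2),
    (-2 ^ (m + 2 * d), 2 ^ (n - 1) + 2 ^ (m + 2 * d - 1),
      (2 ^ (m - d) - 1) * (2 ^ n - 1) / ((2 ^ d + 1) * (2 ^ (2 * d) - 1))),
    (2 ^ n, 0, 1)]

theorem value_eq_of_mem_tableOfEq (hn : n = 2 * m) (hm : 0 < m) {r : ℤ × ℕ × ℚ}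
    (hr : r ∈ tableOfEq n m d) : r.1 = 2 ^ n - 2 * (r.2.1 : ℤ) := by
  have hle : 2 ^ (m - 1) ≤ 2 ^ (n - 1) := Nat.pow_le_pow_right two_pos (by omega)
  have hn2 := mul_pow_sub_one (show n ≠ 0 by omega) (2 : ℤ)
  have hm2 := mul_pow_sub_one hm.ne' (2 : ℤ)
  have hmd2 := mul_pow_sub_one (show m + d ≠ 0 by omega) (2 : ℤ)
  revert r
  simp only [tableOfEq, List.forall_mem_cons, List.not_mem_nil, false_implies, implies_true,
    and_true]
  push_cast [Nat.cast_sub hle]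
  omega

theorem value_eq_of_mem_tableOfEqTwoMul (hn : n = 2 * m) (hm : 0 < m) (hdm : d ≤ m)
    {r : ℤ × ℕ × ℚ} (hr : r ∈ tableOfEqTwoMul n m d) : r.1 = 2 ^ n - 2 * (r.2.1 : ℤ) := by
  have hle : 2 ^ (m + d - 1) ≤ 2 ^ (n - 1) := Nat.pow_le_pow_right two_pos (by omega)
  have hn2 := mul_pow_sub_one (show n ≠ 0 by omega) (2 : ℤ)
  have hm2 := mul_pow_sub_one hm.ne' (2 : ℤ)
  have hmd2 := mul_pow_sub_one (show m + d ≠ 0 by omega) (2 : ℤ)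
  have hm2d2 := mul_pow_sub_one (show m + 2 * d ≠ 0 by omega) (2 : ℤ)
  revert r
  simp only [tableOfEqTwoMul, List.forall_mem_cons, List.not_mem_nil, false_implies,
    implies_true, and_true]
  push_cast [Nat.cast_sub hle]
  omega

end Parameters

section Tables

variable {F : Type*} [Field F] [Fintype F] [Algebra (ZMod 2) F]
  {K : IntermediateField (ZMod 2) F} {n m k d : ℕ}

theorem T_mem_of_gcd_eq (hn : n = 2 * m) (hF : Fintype.card F = 2 ^ n)
    (hK : Nat.card K = 2 ^ m) (hd : d = Nat.gcd m k) (hd' : d = Nat.gcd (m + k) (2 * k))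
    (p : K × F) :
    T hn hF hK k p.1 p.2 ∈ [2 ^ m, -2 ^ m, -2 ^ (m + d), 0, 2 ^ n] := by
  simp only [List.mem_cons, List.not_mem_nil, or_false]
  by_cases hp : p = 0
  · simp only [hp, Prod.fst_zero, Prod.snd_zero, T_zero, or_true]
  · have := T_cases_of_gcd_eq hn hF hK hd hd' hp
    tauto

theorem T_mem_of_gcd_eq_two_mul (hn : n = 2 * m) (hF : Fintype.card F = 2 ^ n)
    (hK : Nat.card K = 2 ^ m) (hd : d = Nat.gcd m k) (hd' : 2 * d = Nat.gcd (m + k) (2 * k))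
    (p : K × F) :
    T hn hF hK k p.1 p.2 ∈ [-2 ^ m, 2 ^ (m + d), -2 ^ (m + 2 * d), 2 ^ n] := by
  simp only [List.mem_cons, List.not_mem_nil, or_false]
  by_cases hp : p = 0
  · simp only [hp, Prod.fst_zero, Prod.snd_zero, T_zero, or_true]
  · have := T_cases_of_gcd_eq_two_mul hn hF hK hd hd' hp
    tauto

theorem nodup_values_of_eq (hn : n = 2 * m) (hm : 0 < m) (hd : 0 < d) :
    [2 ^ m, -2 ^ m, -2 ^ (m + d), 0, (2 ^ n : ℤ)].Nodup := by
  have hpos : (0 : ℤ) < 2 ^ m := by positivity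
  have hmd : (2 : ℤ) ^ m < 2 ^ (m + d) := pow_lt_pow_right₀ one_lt_two (by omega)
  have hmn : (2 : ℤ) ^ m < 2 ^ n := pow_lt_pow_right₀ one_lt_two (by omega)
  simp only [List.nodup_cons, List.mem_cons, List.not_mem_nil, or_false, not_or, List.nodup_nil,
    not_false_eq_true, and_true]
  omega

theorem nodup_values_of_eq_two_mul (hn : n = 2 * m) (hd : 0 < d) (hdm : 2 * d ≤ m) :
    [-2 ^ m, 2 ^ (m + d), -2 ^ (m + 2 * d), (2 ^ n : ℤ)].Nodup := by
  have hpos : (0 : ℤ) < 2 ^ m := by positivity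
  have hmd : (2 : ℤ) ^ (m + d) < 2 ^ n := pow_lt_pow_right₀ one_lt_two (by omega)
  have hmd0 : (0 : ℤ) < 2 ^ (m + d) := by positivity
  have hm2d : (2 : ℤ) ^ m < 2 ^ (m + 2 * d) := pow_lt_pow_right₀ one_lt_two (by omega)
  simp only [List.nodup_cons, List.mem_cons, List.not_mem_nil, or_false, not_or, List.nodup_nil,
    not_false_eq_true, and_true]
  omega

/-- The number of pairs `(α, β)` with `T(α, β) = v`, as a rational number because the tables
express multiplicities as quotients. -/
noncomputable def valueCount (hn : n = 2 * m) (hF : Fintype.card F = 2 ^ n)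
    (hK : Nat.card K = 2 ^ m) (k : ℕ) (v : ℤ) : ℚ :=
  {p : K × F | T hn hF hK k p.1 p.2 = v}.ncard

theorem sum_T_pow_eq_sum_map_valueCount [Fintype K] (hn : n = 2 * m)
    (hF : Fintype.card F = 2 ^ n) (hK : Nat.card K = 2 ^ m) {V : List ℤ} (hV : V.Nodup)
    (hT : ∀ p : K × F, T hn hF hK k p.1 p.2 ∈ V) (j : ℕ) :
    ((∑ p : K × F, T hn hF hK k p.1 p.2 ^ j : ℤ) : ℚ) =
      (V.map fun v : ℤ => (v : ℚ) ^ j * valueCount hn hF hK k v).sum := by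
  rw [sum_pow_eq_sum_map_ncard hV hT, Int.cast_list_sum, List.map_map]
  congr 2
  funext v
  simp only [valueCount, Function.comp_apply, Int.cast_mul, Int.cast_pow, Int.cast_natCast]

theorem valueCount_two_pow (hn : n = 2 * m) (hF : Fintype.card F = 2 ^ n)
    (hK : Nat.card K = 2 ^ m) (hd : 2 * Nat.gcd m k ≤ m) :
    valueCount hn hF hK k (2 ^ n) = 1 := by
  rw [valueCount, ncard_T_eq_two_pow hn hF hK hd, Nat.cast_one]

theorem valueCount_zero (hn : n = 2 * m) (hF : Fintype.card F = 2 ^ n)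
    (hK : Nat.card K = 2 ^ m) (hd : d = Nat.gcd m k) (hd' : d = Nat.gcd (m + k) (2 * k)) :
    valueCount hn hF hK k 0 = 2 ^ (m - d) * (2 ^ n - 1) := by
  rw [valueCount, ← Int.cast_natCast, ncard_T_eq_zero hn hF hK hd hd']
  push_cast
  rfl

theorem sum_T_pow_zero [Fintype K] (hn : n = 2 * m) (hF : Fintype.card F = 2 ^ n)
    (hK : Nat.card K = 2 ^ m) (k : ℕ) :
    ∑ p : K × F, T hn hF hK k p.1 p.2 ^ 0 = 2 ^ m * 2 ^ n := by
  simp only [pow_zero, Finset.sum_const, Finset.card_univ, Fintype.card_prod, hF,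
    ← Nat.card_eq_fintype_card (α := K), hK]
  simp

theorem moments_of_gcd_eq (hn : n = 2 * m) (hF : Fintype.card F = 2 ^ n)
    (hK : Nat.card K = 2 ^ m) (hd : d = Nat.gcd m k) (hd' : d = Nat.gcd (m + k) (2 * k))
    (hdm : 2 * d ≤ m) :
    valueCount hn hF hK k (2 ^ m) + valueCount hn hF hK k (-2 ^ m) +
      valueCount hn hF hK k (-2 ^ (m + d)) + valueCount hn hF hK k 0 + 1 = (2 ^ m) ^ 3 ∧
    2 ^ m * valueCount hn hF hK k (2 ^ m) - 2 ^ m * valueCount hn hF hK k (-2 ^ m) -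
      2 ^ m * 2 ^ d * valueCount hn hF hK k (-2 ^ (m + d)) + (2 ^ m) ^ 2 = (2 ^ m) ^ 3 ∧
    (2 ^ m) ^ 2 * valueCount hn hF hK k (2 ^ m) + (2 ^ m) ^ 2 * valueCount hn hF hK k (-2 ^ m) +
      (2 ^ m * 2 ^ d) ^ 2 * valueCount hn hF hK k (-2 ^ (m + d)) + (2 ^ m) ^ 4 = (2 ^ m) ^ 5 := by
  have := Fintype.ofFinite K
  have hm := exponent_pos hK
  have hdpos : 0 < d := hd ▸ Nat.gcd_pos_of_pos_left _ hm
  have hnm : (2 : ℚ) ^ n = (2 ^ m) ^ 2 := by rw [hn, mul_comm, pow_mul]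
  have hmd : (2 : ℚ) ^ (m + d) = 2 ^ m * 2 ^ d := pow_add _ _ _
  have hmoment := sum_T_pow_eq_sum_map_valueCount hn hF hK (nodup_values_of_eq hn hm hdpos)
    (T_mem_of_gcd_eq hn hF hK hd hd')
  have h0 := hmoment 0
  have h1 := hmoment 1
  have h2 := hmoment 2
  rw [sum_T_pow_zero] at h0
  simp only [pow_one, sum_T] at h1
  rw [sum_T_sq_of_gcd_eq hn hF hK hd hd'] at h2
  simp only [List.map_cons, List.map_nil, List.sum_cons, List.sum_nil,
    valueCount_two_pow hn hF hK (hd ▸ hdm)] at h0 h1 h2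
  push_cast at h0 h1 h2
  simp only [hnm, hmd] at h0 h1 h2
  exact ⟨by linear_combination -h0, by linear_combination -h1, by linear_combination -h2⟩

theorem moments_of_gcd_eq_two_mul (hn : n = 2 * m) (hF : Fintype.card F = 2 ^ n)
    (hK : Nat.card K = 2 ^ m) (hd : d = Nat.gcd m k) (hd' : 2 * d = Nat.gcd (m + k) (2 * k))
    (hdm : 2 * d ≤ m) :
    valueCount hn hF hK k (-2 ^ m) + valueCount hn hF hK k (2 ^ (m + d)) +
      valueCount hn hF hK k (-2 ^ (m + 2 * d)) + 1 = (2 ^ m) ^ 3 ∧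
    -2 ^ m * valueCount hn hF hK k (-2 ^ m) +
      2 ^ m * 2 ^ d * valueCount hn hF hK k (2 ^ (m + d)) -
      2 ^ m * (2 ^ d) ^ 2 * valueCount hn hF hK k (-2 ^ (m + 2 * d)) + (2 ^ m) ^ 2 =
        (2 ^ m) ^ 3 ∧
    (2 ^ m) ^ 2 * valueCount hn hF hK k (-2 ^ m) +
      (2 ^ m * 2 ^ d) ^ 2 * valueCount hn hF hK k (2 ^ (m + d)) +
      (2 ^ m * (2 ^ d) ^ 2) ^ 2 * valueCount hn hF hK k (-2 ^ (m + 2 * d)) + (2 ^ m) ^ 4 =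
        (2 ^ m) ^ 2 * ((2 ^ m) ^ 3 + ((2 ^ m) ^ 2 - 1) * (2 ^ m * 2 ^ d)) := by
  have := Fintype.ofFinite K
  have hdpos : 0 < d := hd ▸ Nat.gcd_pos_of_pos_left _ (exponent_pos hK)
  have hnm : (2 : ℚ) ^ n = (2 ^ m) ^ 2 := by rw [hn, mul_comm, pow_mul]
  have hmd : (2 : ℚ) ^ (m + d) = 2 ^ m * 2 ^ d := pow_add _ _ _
  have hm2d : (2 : ℚ) ^ (m + 2 * d) = 2 ^ m * (2 ^ d) ^ 2 := by rw [← pow_mul', pow_add]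
  have hmoment := sum_T_pow_eq_sum_map_valueCount hn hF hK
    (nodup_values_of_eq_two_mul hn hdpos hdm) (T_mem_of_gcd_eq_two_mul hn hF hK hd hd')
  have h0 := hmoment 0
  have h1 := hmoment 1
  have h2 := hmoment 2
  rw [sum_T_pow_zero] at h0
  simp only [pow_one, sum_T] at h1
  rw [sum_T_sq_of_gcd_eq_two_mul hn hF hK hd hd'] at h2
  simp only [List.map_cons, List.map_nil, List.sum_cons, List.sum_nil,
    valueCount_two_pow hn hF hK (hd ▸ hdm)] at h0 h1 h2
  push_cast at h0 h1 h2
  simp only [hnm, hmd, hm2d] at h0 h1 h2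
  exact ⟨by linear_combination -h0, by linear_combination -h1, by linear_combination -h2⟩

theorem valueCount_eq_of_mem_tableOfEq (hn : n = 2 * m) (hF : Fintype.card F = 2 ^ n)
    (hK : Nat.card K = 2 ^ m) (hd : d = Nat.gcd m k) (hd' : d = Nat.gcd (m + k) (2 * k))
    (hdm : 2 * d ≤ m) {r : ℤ × ℕ × ℚ} (hr : r ∈ tableOfEq n m d) :
    valueCount hn hF hK k r.1 = r.2.2 := by
  have hdpos : 0 < d := hd ▸ Nat.gcd_pos_of_pos_left _ (exponent_pos hK)
  have hnm : (2 : ℚ) ^ n = (2 ^ m) ^ 2 := by rw [hn, mul_comm, pow_mul]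
  have hm : (2 : ℚ) ^ m = 2 ^ d * 2 ^ (m - d) := by rw [← pow_add]; congr 1; omega
  have hnd : (2 : ℚ) ^ (n - d + 1) = 2 * 2 ^ m * 2 ^ (m - d) := by
    rw [← pow_succ', ← pow_add]; congr 1; omega
  have hz := valueCount_zero hn hF hK hd hd'
  obtain ⟨h0, h1, h2⟩ := moments_of_gcd_eq hn hF hK hd hd' hdm
  obtain ⟨ha, hb, he⟩ := multiplicities_of_moments hm (mul_pow_sub_one hdpos.ne' 2).symm
    (by positivity) (le_self_pow₀ one_le_two hdpos.ne') (hnm ▸ hz) h0 h1 h2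
  revert r
  simp only [tableOfEq, List.forall_mem_cons, List.not_mem_nil, false_implies, implies_true,
    and_true]
  rw [ha, hb, he, hz, hnd, hnm, pow_mul' _ 2 d, pow_succ' _ m]
  exact ⟨rfl, rfl, rfl, rfl, valueCount_two_pow hn hF hK (hd ▸ hdm)⟩

theorem valueCount_eq_of_mem_tableOfEqTwoMul (hn : n = 2 * m) (hF : Fintype.card F = 2 ^ n)
    (hK : Nat.card K = 2 ^ m) (hd : d = Nat.gcd m k) (hd' : 2 * d = Nat.gcd (m + k) (2 * k))
    (hdm : 2 * d ≤ m) {r : ℤ × ℕ × ℚ} (hr : r ∈ tableOfEqTwoMul n m d) :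
    valueCount hn hF hK k r.1 = r.2.2 := by
  have hdpos : 0 < d := hd ▸ Nat.gcd_pos_of_pos_left _ (exponent_pos hK)
  have hnm : (2 : ℚ) ^ n = (2 ^ m) ^ 2 := by rw [hn, mul_comm, pow_mul]
  have hm : (2 : ℚ) ^ m = 2 ^ d * 2 ^ (m - d) := by rw [← pow_add]; congr 1; omega
  have hmd : (2 : ℚ) ^ (m - d) = 2 ^ d * 2 ^ (m - 2 * d) := by rw [← pow_add]; congr 1; omega
  have hn2d : (2 : ℚ) ^ (n - 2 * d) = (2 ^ (m - d)) ^ 2 := by rw [← pow_mul]; congr 1; omega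
  have hn3d : (2 : ℚ) ^ (n - 3 * d) = 2 ^ (m - d) * 2 ^ (m - 2 * d) := by
    rw [← pow_add]; congr 1; omega
  obtain ⟨h0, h1, h2⟩ := moments_of_gcd_eq_two_mul hn hF hK hd hd' hdm
  obtain ⟨hx, hy, hw⟩ := multiplicities_of_moments_two_mul hm hmd (by positivity)
    (le_self_pow₀ one_le_two hdpos.ne') h0 h1 h2
  revert r
  simp only [tableOfEqTwoMul, List.forall_mem_cons, List.not_mem_nil, false_implies,
    implies_true, and_true]
  rw [hx, hy, hw, hn2d, hn3d, hnm, pow_mul' _ 2 d, pow_mul' _ 3 d]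
  exact ⟨rfl, rfl, rfl, valueCount_two_pow hn hF hK (hd ▸ hdm)⟩

theorem isDistributionTable_of_bijOn (hn : n = 2 * m) (hF : Fintype.card F = 2 ^ n)
    (hK : Nat.card K = 2 ^ m) {π : Fˣ} (hπ : ∀ y : Fˣ, y ∈ Subgroup.zpowers π)
    (hbij : Set.BijOn (fun p : K × F => word hn hF hK k π p.1 p.2) Set.univ
      (codeC1 n m k π : Set (Fin (2 ^ n - 1) → ZMod 2)))
    {rows : List (ℤ × ℕ × ℚ)} (hweight : ∀ r ∈ rows, r.1 = 2 ^ n - 2 * (r.2.1 : ℤ))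
    (hvalue : ∀ p : K × F, T hn hF hK k p.1 p.2 ∈ rows.map Prod.fst)
    (hcount : ∀ r ∈ rows, valueCount hn hF hK k r.1 = r.2.2) :
    IsDistributionTable hn hF hK k π rows := by
  have hiff : ∀ r ∈ rows, ∀ (α : K) (β : F),
      T hn hF hK k α β = r.1 ↔ hammingNorm (word hn hF hK k π α β) = r.2.1 := by
    intro r hr α β
    rw [T_eq_sub_hammingNorm hn hF hK k hπ, hweight r hr]
    omega
  have hrow (α : K) (β : F) : ∃ r ∈ rows, T hn hF hK k α β = r.1 := by
    obtain ⟨r, hr, h⟩ := List.mem_map.mp (hvalue (α, β))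
    exact ⟨r, hr, h.symm⟩
  refine ⟨fun α β => ?_, hcount, fun w hw => ?_, fun r hr => ?_⟩
  · obtain ⟨r, hr, h⟩ := hrow α β
    exact ⟨r, hr, h, (hiff r hr α β).mp h⟩
  · obtain ⟨⟨α, β⟩, -, rfl⟩ := hbij.surjOn hw
    obtain ⟨r, hr, h⟩ := hrow α β
    exact ⟨r, hr, (hiff r hr α β).mp h⟩
  · have himage : {w | w ∈ codeC1 n m k π ∧ hammingNorm w = r.2.1} =
        (fun p : K × F => word hn hF hK k π p.1 p.2) ''
          {p : K × F | T hn hF hK k p.1 p.2 = r.1} := by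
      ext w
      constructor
      · rintro ⟨hw, hnorm⟩
        obtain ⟨p, -, rfl⟩ := hbij.surjOn hw
        exact ⟨p, (hiff r hr p.1 p.2).mpr hnorm, rfl⟩
      · rintro ⟨p, hp, rfl⟩
        exact ⟨hbij.mapsTo (Set.mem_univ p), (hiff r hr p.1 p.2).mp hp⟩
    rw [himage, (hbij.injOn.mono (Set.subset_univ _)).ncard_image]
    exact hcount r hr

theorem isDistributionTable_tableOfEq (hn : n = 2 * m) (hF : Fintype.card F = 2 ^ n)
    (hK : Nat.card K = 2 ^ m) (hd : d = Nat.gcd m k) (hd' : d = Nat.gcd (m + k) (2 * k))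
    (hdm : 2 * d ≤ m) {π : Fˣ} (hπ : ∀ y : Fˣ, y ∈ Subgroup.zpowers π) :
    IsDistributionTable hn hF hK k π (tableOfEq n m d) :=
  isDistributionTable_of_bijOn hn hF hK hπ (bijOn_word hn hF hK (hd ▸ hdm) hπ)
    (fun _ => value_eq_of_mem_tableOfEq hn (exponent_pos hK)) (T_mem_of_gcd_eq hn hF hK hd hd')
    fun _ => valueCount_eq_of_mem_tableOfEq hn hF hK hd hd' hdm

theorem isDistributionTable_tableOfEqTwoMul (hn : n = 2 * m) (hF : Fintype.card F = 2 ^ n)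
    (hK : Nat.card K = 2 ^ m) (hd : d = Nat.gcd m k) (hd' : 2 * d = Nat.gcd (m + k) (2 * k))
    (hdm : 2 * d ≤ m) {π : Fˣ} (hπ : ∀ y : Fˣ, y ∈ Subgroup.zpowers π) :
    IsDistributionTable hn hF hK k π (tableOfEqTwoMul n m d) :=
  isDistributionTable_of_bijOn hn hF hK hπ (bijOn_word hn hF hK (hd ▸ hdm) hπ)
    (fun _ => value_eq_of_mem_tableOfEqTwoMul hn (exponent_pos hK) (by omega))
    (T_mem_of_gcd_eq_two_mul hn hF hK hd hd')
    fun _ => valueCount_eq_of_mem_tableOfEqTwoMul hn hF hK hd hd' hdm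

end Tables

end GenKasami

theorem mainTheorem1 {F : Type*} [Field F] [Fintype F] [Algebra (ZMod 2) F]
    (K : IntermediateField (ZMod 2) F) (n m k d d' : ℕ)
    (hn : n = 2 * m) (hk1 : 1 ≤ k) (hk2 : k ≤ n - 1) (hkm : k ≠ m)
    (hd : d = Nat.gcd m k) (hd' : d' = Nat.gcd (m + k) (2 * k))
    (hF : Fintype.card F = 2 ^ n) (hK : Nat.card K = 2 ^ m)
    (π : Fˣ) (hπ : ∀ y : Fˣ, y ∈ Subgroup.zpowers π) :
    Set.BijOn (fun p : K × F => GenKasami.word hn hF hK k π p.1 p.2) Set.univ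
        (GenKasami.codeC1 n m k π : Set (Fin (2 ^ n - 1) → ZMod 2)) ∧
    (d' = d → GenKasami.IsDistributionTable hn hF hK k π
      [ (2 ^ m, 2 ^ (n - 1) - 2 ^ (m - 1),
          2 ^ (d - 1) * (2 ^ m - 1) * (2 ^ n + 2 ^ (m + 1) + 1) / (2 ^ d + 1)),
        (-2 ^ m, 2 ^ (n - 1) + 2 ^ (m - 1),
          2 ^ (d - 1) * (2 ^ m - 1) * (2 ^ n - 2 ^ (n - d + 1) + 1) / (2 ^ d - 1)),
        (-2 ^ (m + d), 2 ^ (n - 1) + 2 ^ (m + d - 1),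
          (2 ^ (m - d) - 1) * (2 ^ n - 1) / (2 ^ (2 * d) - 1)),
        (0, 2 ^ (n - 1), 2 ^ (m - d) * (2 ^ n - 1)),
        (2 ^ n, 0, 1) ]) ∧
    (d' = 2 * d → GenKasami.IsDistributionTable hn hF hK k π
      [ (-2 ^ m, 2 ^ (n - 1) + 2 ^ (m - 1),
          2 ^ (3 * d) * (2 ^ m - 1) *
            (2 ^ n - 2 ^ (n - 2 * d) - 2 ^ (n - 3 * d) + 2 ^ m - 2 ^ (m - d) + 1) /
              ((2 ^ d + 1) * (2 ^ (2 * d) - 1))),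
        (2 ^ (m + d), 2 ^ (n - 1) - 2 ^ (m + d - 1),
          2 ^ d * (2 ^ n - 1) * (2 ^ m + 2 ^ (m - d) + 2 ^ (m - 2 * d) + 1) / (2 ^ d + 1) ^ 2),
        (-2 ^ (m + 2 * d), 2 ^ (n - 1) + 2 ^ (m + 2 * d - 1),
          (2 ^ (m - d) - 1) * (2 ^ n - 1) / ((2 ^ d + 1) * (2 ^ (2 * d) - 1))),
        (2 ^ n, 0, 1) ]) := by
  have hdm : 2 * Nat.gcd m k ≤ m :=
    GenKasami.two_mul_gcd_le (GenKasami.exponent_pos hK) hn hk1 hk2 hkm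
  refine ⟨GenKasami.bijOn_word hn hF hK hdm hπ, fun h => ?_, fun h => ?_⟩
  · exact GenKasami.isDistributionTable_tableOfEq hn hF hK hd (h.symm.trans hd') (hd ▸ hdm) hπ
  · exact GenKasami.isDistributionTable_tableOfEqTwoMul hn hF hK hd (h.symm.trans hd')
      (hd ▸ hdm) hπ
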